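/- A tournament is a loopless directed graph in which every two distinct vertices are joined by exactly one arc. Arc-Disjoint Cycle Packing in Tournaments (ACT) is the following problem, with parameter $k$: given a tournament $T$ and a positive integer $k$, decide whether $T$ contains $k$ pairwise arc-disjoint directed cycles. **Theorem.** ACT admits a kernel with $O(k)$ vertices, more precisely with at most $12k$ vertices. That is, there is a polynomial-time algorithm that transforms every instance $(T,k)$ of ACT into an instance $(T',k')$ of ACT such that $T$ has $k$ arc-disjoint cycles if and only if $T'$ has $k'$ arc-disjoint cycles, $|V(T')| \le 12k$, and $1 \le k' \le k$. -/

import Mathlib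

/-! ## Tournaments, cycles and arc-disjoint cycle packings -/

/-- A tournament: a loopless digraph in which any two distinct vertices are joined by exactly one
of the two possible arcs. -/
structure Digraph.IsTournament {V : Type*} (G : Digraph V) : Prop where
  loopless : ∀ u, ¬ G.Adj u u
  exactlyOne : ∀ u v, u ≠ v → Xor (G.Adj u v) (G.Adj v u)

/-- The arcs of the closed sequence `(v₁, …, vₘ)`:
`(v₁, v₂), …, (vₘ₋₁, vₘ), (vₘ, v₁)`. -/
def cycleArcs {V : Type*} (c : List V) : List (V × V) :=
  c.zip (c.rotate 1)

/-- A (directed) cycle of `G`: a nonempty sequence of distinct vertices `(v₁, …, vₘ)` such that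
`(vᵢ, vᵢ₊₁)` for `i < m` and `(vₘ, v₁)` are arcs of `G`. -/
structure Digraph.IsCycle {V : Type*} (G : Digraph V) (c : List V) : Prop where
  ne_nil : c ≠ []
  nodup : c.Nodup
  arcs_adj : ∀ e ∈ cycleArcs c, G.Adj e.1 e.2

/-- `G` has `k` pairwise arc-disjoint cycles. -/
def Digraph.HasArcDisjointCycles {V : Type*} (G : Digraph V) (k : ℕ) : Prop :=
  ∃ c : Fin k → List V, (∀ i, G.IsCycle (c i)) ∧
    ∀ i j, i ≠ j → (cycleArcs (c i)).Disjoint (cycleArcs (c j))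

/-- An instance of Arc-Disjoint Cycle Packing in Tournaments (ACT): a tournament, given on the
vertex set `{0, …, n - 1}`, and a positive integer `k` (the parameter). -/
structure ACTInstance where
  /-- number of vertices -/
  n : ℕ
  /-- the tournament -/
  T : Digraph (Fin n)
  isTournament : T.IsTournament
  /-- the parameter -/
  k : ℕ
  k_pos : 0 < k

/-- `(T, k)` is a yes-instance if `T` has `k` arc-disjoint cycles. -/
def ACTInstance.IsYes (I : ACTInstance) : Prop :=
  I.T.HasArcDisjointCycles I.k

open Classical in
/-- The encoding of an instance: `n`, then `k`, then the `n × n` adjacency matrix, row by row: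
the entry with index `n * u + v` is `1` if `(u, v)` is an arc and `0` otherwise. -/
noncomputable def ACTInstance.encode (I : ACTInstance) : List ℕ :=
  I.n :: I.k ::
    List.ofFn fun x : Fin (I.n * I.n) => if I.T.Adj x.divNat x.modNat then 1 else 0

/-! ## Random access machines and polynomial time

The machine model is the random access machine with addition and (truncated) subtraction as its
only arithmetic, programmed by structured programs. Every elementary operation has cost one. As
there is no multiplication, the numbers have at most (input length + running time + constant)
bits, so polynomial time on this machine is the same as polynomial time on a Turing machine. -/

namespace RAM

/-- The memory: `m a i` is cell `i` of array `a`. A program mentions only finitely many arrays by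
name; the cells of an array are addressed indirectly. -/
abbrev Mem := ℕ → ℕ → ℕ

/-- Expressions: constants, the value of a cell of the array `a`, sum, truncated difference. -/
inductive Expr : Type
  | const (n : ℕ) : Expr
  | read (a : ℕ) (i : Expr) : Expr
  | add (x y : Expr) : Expr
  | sub (x y : Expr) : Expr

/-- The value of an expression. -/
def Expr.eval (m : Mem) : Expr → ℕ
  | .const n => n
  | .read a i => m a (i.eval m)
  | .add x y => x.eval m + y.eval m
  | .sub x y => x.eval m - y.eval m

/-- The number of elementary operations in the evaluation of an expression. -/
def Expr.cost : Expr → ℕ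
  | .const _ => 1
  | .read _ i => i.cost + 1
  | .add x y => x.cost + y.cost + 1
  | .sub x y => x.cost + y.cost + 1

/-- Programs: do nothing; store the value of `e` in the cell of the array `a` with the index given
by `i`; run two programs in turn; branch on whether `e` is nonzero; repeat as long as `e` is
nonzero. -/
inductive Program : Type
  | skip : Program
  | write (a : ℕ) (i e : Expr) : Program
  | seq (p q : Program) : Program
  | ite (e : Expr) (p q : Program) : Program
  | loop (e : Expr) (p : Program) : Program

/-- The memory `m` after `v` has been stored in cell `i` of array `a`. -/
def Mem.set (m : Mem) (a i v : ℕ) : Mem :=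
  Function.update m a (Function.update (m a) i v)

/-- `Exec p m t m'`: the program `p`, started with memory `m`, halts after exactly `t` steps with
memory `m'`. -/
inductive Exec : Program → Mem → ℕ → Mem → Prop
  | skip (m : Mem) : Exec .skip m 1 m
  | write (a : ℕ) (i e : Expr) (m : Mem) :
      Exec (.write a i e) m (i.cost + e.cost + 1) (m.set a (i.eval m) (e.eval m))
  | seq {p q : Program} {m m' m'' : Mem} {t t' : ℕ} :
      Exec p m t m' → Exec q m' t' m'' → Exec (.seq p q) m (t + t') m''
  | ite_true {e : Expr} {p q : Program} {m m' : Mem} {t : ℕ} :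
      e.eval m ≠ 0 → Exec p m t m' → Exec (.ite e p q) m (e.cost + 1 + t) m'
  | ite_false {e : Expr} {p q : Program} {m m' : Mem} {t : ℕ} :
      e.eval m = 0 → Exec q m t m' → Exec (.ite e p q) m (e.cost + 1 + t) m'
  | loop_true {e : Expr} {p : Program} {m m' m'' : Mem} {t t' : ℕ} :
      e.eval m ≠ 0 → Exec p m t m' → Exec (.loop e p) m' t' m'' →
        Exec (.loop e p) m (e.cost + 1 + t + t') m''
  | loop_false {e : Expr} {p : Program} {m : Mem} :
      e.eval m = 0 → Exec (.loop e p) m (e.cost + 1) m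

/-- The contents of an array that holds the list `l`, followed by zeros. -/
def arrayOf (l : List ℕ) : ℕ → ℕ :=
  fun i => l.getD i 0

/-- The initial memory on input `l`: array `0` holds `l`, all other cells are zero. -/
def initMem (l : List ℕ) : Mem :=
  fun a => if a = 0 then arrayOf l else fun _ => 0

/-- The length of the input in bits: the numbers are written in binary, and one bit is counted
for every separator. -/
def inputSize (l : List ℕ) : ℕ :=
  (l.map fun x => Nat.size x + 1).sum

/-- `f` is computable in polynomial time with respect to the encodings `encα` and `encβ`: there is
a program that, for every `x`, started with the code of `x` in array `0`, halts with the code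
of `f x` in array `1`, after a number of steps that is at most a fixed polynomial in the length of
the input. -/
def PolyTimeComputable {α β : Type*} (encα : α → List ℕ) (encβ : β → List ℕ) (f : α → β) : Prop :=
  ∃ (P : Program) (p : Polynomial ℕ), ∀ x : α, ∃ (t : ℕ) (m : Mem),
    Exec P (initMem (encα x)) t m ∧ t ≤ p.eval (inputSize (encα x)) ∧ m 1 = arrayOf (encβ (f x))

end RAM

/-! Pack arc-disjoint triangles greedily: `t` of them, with arc set `X`. If `t ≥ k`, the answer is
yes. Otherwise the digraph `D` of the arcs outside `X` has no directed triangle, and at most `3t`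
pairs are not joined in `D`. Such a digraph has an ordering with no more backward arcs than missing
pairs. To find it, keep an ordered partition and split a class at a pivot `v` into the rest, `v`,
and the out-neighbours of `v`. Each new backward arc is the second arc of an induced path that
starts in `v`, and each induced path with midpoint `v` gives a new separated missing pair. Every
induced path has one start and one midpoint, so some pivot gains at least as many missing pairs as
backward arcs (`card_backwardPairs_splitLabel_le`, `exists_pivot`). A triangle has at most two
backward arcs, so the tournament has at most `3t + 2t = 5t` of them
(`TrianglePacking.card_backwardPairs_le`), with at most `10t` endpoints.

The other vertices form the set `U` of unaffected vertices. An unaffected vertex forms a triangle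
with every backward arc that spans it. Let `S ⊆ U` maximize `|S| - |F(S)|`, where `F(S)` is the set
of backward arcs spanning a vertex of `S`. By Hall's theorem, `F(S)` can be matched into `S`, and `U
\ S` into the backward arcs outside `F(S)` (`IsOptimal.exists_matching`,
`IsOptimal.exists_matching_compl`). This yields `|F(S)| + |U \ S|` arc-disjoint triangles; if these
are at least `k`, the answer is yes again. Otherwise delete `S`, reverse the arcs of `F(S)` and
lower `k` by `|F(S)|`. This is an equivalence because `F(S)` accounts for exactly `|F(S)|` cycles
(`IsOptimal.reduce_iff`). At most `10t + |U \ S| ≤ 11(k - 1)` vertices remain.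

The set `S` is found by dynamic programming over its largest element. The algorithm is written in a
small language whose loops all have `n` iterations. Every command of it compiles to a
polynomial-time program (`Cmd.compile_spec`), so only the functional correctness of the algorithm
remains to be shown. -/

namespace RAM

/-! ## A language of bounded loops

Expressions with bounded sums and commands with bounded loops, where the bound is always the first
number of the input. They have a functional semantics, and they are compiled to programs of the
random access machine that run in polynomial time. -/

/-- Expressions with named variables, the input array, work arrays, and sums over `x < n`, where
`n` is the first number of the input. -/
inductive HExpr : Type
  | const (c : ℕ) : HExpr
  | var (x : ℕ) : HExpr
  | inp (e : HExpr) : HExpr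
  | read (a : ℕ) (e : HExpr) : HExpr
  | add (e f : HExpr) : HExpr
  | sub (e f : HExpr) : HExpr
  | ite (c e f : HExpr) : HExpr
  | sum (x : ℕ) (e : HExpr) : HExpr

/-- The value of an expression for the input array `I`, work arrays `S` and variables `v`. -/
def HExpr.eval (I : ℕ → ℕ) (S : Mem) : HExpr → (ℕ → ℕ) → ℕ
  | .const c, _ => c
  | .var x, v => v x
  | .inp e, v => I (e.eval I S v)
  | .read a e, v => S a (e.eval I S v)
  | .add e f, v => e.eval I S v + f.eval I S v
  | .sub e f, v => e.eval I S v - f.eval I S v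
  | .ite c e f, v => if c.eval I S v ≠ 0 then e.eval I S v else f.eval I S v
  | .sum x e, v => ∑ i ∈ Finset.range (I 0), e.eval I S (Function.update v x i)

/-- Commands. `iter x p` runs `p` for `x = 0, …, n - 1`, where `n` is the first number of the
input. -/
inductive Cmd : Type
  | skip : Cmd
  | write (a : ℕ) (i e : HExpr) : Cmd
  | seq (p q : Cmd) : Cmd
  | ite (c : HExpr) (p q : Cmd) : Cmd
  | iter (x : ℕ) (p : Cmd) : Cmd

/-- The work arrays after the execution of a command. -/
def Cmd.denote (I : ℕ → ℕ) : Cmd → (ℕ → ℕ) → Mem → Mem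
  | .skip, _, S => S
  | .write a i e, v, S => S.set a (i.eval I S v) (e.eval I S v)
  | .seq p q, v, S => q.denote I v (p.denote I v S)
  | .ite c p q, v, S => if c.eval I S v ≠ 0 then p.denote I v S else q.denote I v S
  | .iter x p, v, S => Nat.rec S (fun i S => p.denote I (Function.update v x i) S) (I 0)

theorem Cmd.iter_induction {I : ℕ → ℕ} {x : ℕ} {p : Cmd} {v : ℕ → ℕ} {S : Mem}
    (P : ℕ → Mem → Prop) (h0 : P 0 S)
    (h1 : ∀ i < I 0, ∀ S, P i S → P (i + 1) (p.denote I (Function.update v x i) S)) :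
    P (I 0) ((Cmd.iter x p).denote I v S) := by
  have : ∀ j ≤ I 0, P j (Nat.rec S (fun i S => p.denote I (Function.update v x i) S) j) := by
    intro j
    induction j with
    | zero => intro _; exact h0
    | succ j ih => intro hj; exact h1 j (by omega) _ (ih (by omega))
  exact this _ le_rfl

/-! ### Compilation to the random access machine -/

/-- The array of the machine that holds a work array. Array `0` holds the input, array `2` is a
stack, array `3` holds the variables. -/
def arr (a : ℕ) : ℕ := if a = 0 then 1 else a + 3

theorem arr_injective : Function.Injective arr := by
  intro a b h
  unfold arr at h
  split_ifs at h <;> omega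

theorem arr_ne_zero (a : ℕ) : arr a ≠ 0 := by unfold arr; split_ifs <;> omega
theorem arr_ne_two (a : ℕ) : arr a ≠ 2 := by unfold arr; split_ifs <;> omega
theorem arr_ne_three (a : ℕ) : arr a ≠ 3 := by unfold arr; split_ifs <;> omega

/-- The stack cell `d`. -/
abbrev top (d : ℕ) : Expr := .read 2 (.const d)

/-- Compilation of an expression; the value is stored in the stack cell `d`. -/
def HExpr.compile : HExpr → ℕ → Program
  | .const c, d => .write 2 (.const d) (.const c)
  | .var x, d => .write 2 (.const d) (.read 3 (.const x))
  | .inp e, d => .seq (e.compile d) (.write 2 (.const d) (.read 0 (top d)))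
  | .read a e, d => .seq (e.compile d) (.write 2 (.const d) (.read (arr a) (top d)))
  | .add e f, d => .seq (e.compile d) (.seq (f.compile (d + 1))
      (.write 2 (.const d) (.add (top d) (top (d + 1)))))
  | .sub e f, d => .seq (e.compile d) (.seq (f.compile (d + 1))
      (.write 2 (.const d) (.sub (top d) (top (d + 1)))))
  | .ite c e f, d => .seq (c.compile d) (.ite (top d) (e.compile d) (f.compile d))
  | .sum x e, d =>
      -- Cell `d` accumulates the sum, cell `d + 1` saves the old value of `x`, and the body works
      -- from `d + 2` on.
      .seq (.seq (.seq (.write 2 (.const d) (.const 0))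
        (.seq (.write 2 (.const (d + 1)) (.read 3 (.const x))) (.write 3 (.const x) (.const 0))))
      (.loop (.sub (.read 0 (.const 0)) (.read 3 (.const x)))
        (.seq (e.compile (d + 2)) (.seq (.write 2 (.const d) (.add (top d) (top (d + 2))))
          (.write 3 (.const x) (.add (.read 3 (.const x)) (.const 1)))))))
      (.write 3 (.const x) (top (d + 1)))

/-- Compilation of a command; the stack cells below `d` are not changed. -/
def Cmd.compile : Cmd → ℕ → Program
  | .skip, _ => .skip
  | .write a i e, d => .seq (i.compile d) (.seq (e.compile (d + 1))
      (.write (arr a) (top d) (top (d + 1))))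
  | .seq p q, d => .seq (p.compile d) (q.compile d)
  | .ite c p q, d => .seq (c.compile d) (.ite (top d) (p.compile d) (q.compile d))
  | .iter x p, d =>
      .seq (.seq (.seq (.write 2 (.const d) (.read 3 (.const x))) (.write 3 (.const x) (.const 0)))
      (.loop (.sub (.read 0 (.const 0)) (.read 3 (.const x)))
        (.seq (p.compile (d + 1))
          (.write 3 (.const x) (.add (.read 3 (.const x)) (.const 1))))))
      (.write 3 (.const x) (top d))

/-! ### Composition of polynomial running times -/

/-- From every memory, `P` halts in a memory related to the initial one by `R`, in polynomial time
in the first number of the input, which is not changed. -/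
def Polytime (P : Program) (R : Mem → Mem → Prop) : Prop :=
  ∃ p : Polynomial ℕ, ∀ m, ∃ t m', Exec P m t m' ∧ t ≤ p.eval (m 0 0) ∧ m' 0 = m 0 ∧ R m m'

theorem Polytime.mono {P : Program} {R R' : Mem → Mem → Prop} (h : Polytime P R)
    (hR : ∀ m m', m' 0 = m 0 → R m m' → R' m m') : Polytime P R' := by
  obtain ⟨p, hp⟩ := h
  refine ⟨p, fun m => ?_⟩
  obtain ⟨t, m', h1, h2, h3, h4⟩ := hp m
  exact ⟨t, m', h1, h2, h3, hR _ _ h3 h4⟩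

theorem Polytime.seq {P Q : Program} {R R' : Mem → Mem → Prop} (h : Polytime P R)
    (h' : Polytime Q R') :
    Polytime (.seq P Q) (fun m m'' => ∃ m', m' 0 = m 0 ∧ R m m' ∧ R' m' m'') := by
  obtain ⟨p, hp⟩ := h
  obtain ⟨q, hq⟩ := h'
  refine ⟨p + q, fun m => ?_⟩
  obtain ⟨t, m', h1, h2, h3, h4⟩ := hp m
  obtain ⟨t', m'', h1', h2', h3', h4'⟩ := hq m'
  refine ⟨_, m'', h1.seq h1', ?_, h3'.trans h3, m', h3, h4, h4'⟩
  rw [Polynomial.eval_add]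
  rw [h3] at h2'
  omega

theorem Polytime.write (a : ℕ) (i e : Expr) (ha : a ≠ 0) :
    Polytime (.write a i e) (fun m m' => m' = m.set a (i.eval m) (e.eval m)) := by
  refine ⟨Polynomial.C (i.cost + e.cost + 1), fun m => ⟨_, _, .write a i e m, ?_, ?_, rfl⟩⟩
  · simp
  · simp [Mem.set, Function.update_of_ne ha.symm]

theorem Polytime.ite {P Q : Program} {e : Expr} {R R' : Mem → Mem → Prop} (h : Polytime P R)
    (h' : Polytime Q R') :
    Polytime (.ite e P Q) (fun m m' => if e.eval m ≠ 0 then R m m' else R' m m') := by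
  obtain ⟨p, hp⟩ := h
  obtain ⟨q, hq⟩ := h'
  refine ⟨Polynomial.C (e.cost + 1) + p + q, fun m => ?_⟩
  by_cases he : e.eval m = 0
  · obtain ⟨t, m', h1, h2, h3, h4⟩ := hq m
    refine ⟨_, m', .ite_false he h1, ?_, h3, by simpa [he] using h4⟩
    simp only [Polynomial.eval_add, Polynomial.eval_C]; omega
  · obtain ⟨t, m', h1, h2, h3, h4⟩ := hp m
    refine ⟨_, m', .ite_true he h1, ?_, h3, by simpa [he] using h4⟩
    simp only [Polynomial.eval_add, Polynomial.eval_C]; omega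

/-- The invariant counts completed iterations and refers to the memory `m₀` before the
initialization. The guard equals the number of iterations that remain, so the body runs exactly `m₀
0 0` times, and its polynomial bound is multiplied by that number. -/
theorem Polytime.init_loop {P Q : Program} {e : Expr} {R₀ R : Mem → Mem → Prop}
    (hQ : Polytime Q R₀) (hP : Polytime P R) (Inv : Mem → ℕ → Mem → Prop)
    (h0 : ∀ m₀ m, m 0 = m₀ 0 → R₀ m₀ m → Inv m₀ 0 m)
    (hg : ∀ m₀ i m, m 0 = m₀ 0 → Inv m₀ i m → e.eval m = m₀ 0 0 - i)
    (hs : ∀ m₀ i m m', m 0 = m₀ 0 → m' 0 = m₀ 0 → i < m₀ 0 0 → Inv m₀ i m → R m m' →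
      Inv m₀ (i + 1) m') :
    Polytime (.seq Q (.loop e P)) (fun m m' => Inv m (m 0 0) m') := by
  obtain ⟨q, hq⟩ := hQ
  obtain ⟨p, hp⟩ := hP
  refine ⟨q + (Polynomial.X * (p + Polynomial.C (e.cost + 1)) + Polynomial.C (e.cost + 1)),
    fun m₀ => ?_⟩
  have key : ∀ j ≤ m₀ 0 0, ∀ m, m 0 = m₀ 0 → Inv m₀ (m₀ 0 0 - j) m →
      ∃ t m', Exec (.loop e P) m t m' ∧ t ≤ j * (p.eval (m₀ 0 0) + (e.cost + 1)) + (e.cost + 1) ∧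
        m' 0 = m₀ 0 ∧ Inv m₀ (m₀ 0 0) m' := by
    intro j
    induction j with
    | zero =>
      intro _ m hm hI
      refine ⟨_, m, .loop_false ?_, by simp, hm, by simpa using hI⟩
      rw [hg _ _ _ hm hI]; simp
    | succ j ih =>
      intro hj m hm hI
      obtain ⟨t, m', h1, h2, h3, h4⟩ := hp m
      have h5 := hs m₀ _ m m' hm (h3.trans hm) (by omega) hI h4
      rw [show m₀ 0 0 - (j + 1) + 1 = m₀ 0 0 - j by omega] at h5
      obtain ⟨t', m'', h1', h2', h3', h4'⟩ := ih (by omega) m' (h3.trans hm) h5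
      refine ⟨_, m'', .loop_true ?_ h1 h1', ?_, h3', h4'⟩
      · rw [hg _ _ _ hm hI]; omega
      · rw [hm] at h2
        rw [Nat.succ_mul]; omega
  obtain ⟨t, m, h1, h2, h3, h4⟩ := hq m₀
  obtain ⟨t', m', h1', h2', h3', h4'⟩ :=
    key (m₀ 0 0) le_rfl m h3 (by simpa using h0 m₀ m h3 h4)
  refine ⟨_, m', h1.seq h1', ?_, h3', h4'⟩
  simp only [Polynomial.eval_add, Polynomial.eval_mul, Polynomial.eval_X, Polynomial.eval_C]
  omega

/-- The contents of the work arrays. -/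
def work (m : Mem) : Mem := fun a => m (arr a)

/-- Since the cells below `d` are preserved, a binary operation can keep its first operand in `d`
while the second is computed from `d + 1` on. Arrays other than the stack are unchanged because a
sum restores its variable at the end. -/
theorem HExpr.compile_spec (e : HExpr) : ∀ d, Polytime (e.compile d) (fun m m' =>
    m' 2 d = e.eval (m 0) (work m) (m 3) ∧ (∀ j < d, m' 2 j = m 2 j) ∧ ∀ a ≠ 2, m' a = m a) := by
  have hw : ∀ m m' : Mem, (∀ a ≠ 2, m' a = m a) → work m' = work m := fun m m' h =>
    funext fun a => h _ (arr_ne_two a)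
  induction e with
  | const c =>
    intro d
    refine (Polytime.write _ _ _ (by norm_num)).mono ?_
    rintro m m' - rfl
    refine ⟨by simp [Mem.set, Expr.eval, eval], fun j hj => ?_, fun a ha => ?_⟩
    · simp [Mem.set, Expr.eval, hj.ne]
    · simp [Mem.set, ha]
  | var x =>
    intro d
    refine (Polytime.write _ _ _ (by norm_num)).mono ?_
    rintro m m' - rfl
    refine ⟨by simp [Mem.set, Expr.eval, eval], fun j hj => ?_, fun a ha => ?_⟩
    · simp [Mem.set, Expr.eval, hj.ne]
    · simp [Mem.set, ha]
  | inp e ih =>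
    intro d
    refine ((ih d).seq (Polytime.write _ _ _ (by norm_num))).mono ?_
    rintro m m' - ⟨m₁, h0, ⟨h1, h2, h3⟩, rfl⟩
    refine ⟨by simp [Mem.set, Expr.eval, eval, h1, h0], fun j hj => ?_, fun a ha => ?_⟩
    · simp [Mem.set, Expr.eval, hj.ne, h2 j hj]
    · simp [Mem.set, ha, h3]
  | read a e ih =>
    intro d
    refine ((ih d).seq (Polytime.write _ _ _ (by norm_num))).mono ?_
    rintro m m' - ⟨m₁, h0, ⟨h1, h2, h3⟩, rfl⟩
    refine ⟨by simp [Mem.set, Expr.eval, eval, h1, h3 _ (arr_ne_two a), work],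
      fun j hj => ?_, fun a ha => ?_⟩
    · simp [Mem.set, Expr.eval, hj.ne, h2 j hj]
    · simp [Mem.set, ha, h3]
  | add e f ihe ihf =>
    intro d
    refine ((ihe d).seq ((ihf (d + 1)).seq (Polytime.write _ _ _ (by norm_num)))).mono ?_
    rintro m m' - ⟨m₁, h0, ⟨h1, h2, h3⟩, m₂, h0', ⟨h1', h2', h3'⟩, rfl⟩
    rw [hw _ _ h3, h0, h3 _ (by norm_num)] at h1'
    refine ⟨by simp [Mem.set, Expr.eval, eval, h1, h1', h2' d], fun j hj => ?_, fun a ha => ?_⟩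
    · simp [Mem.set, Expr.eval, hj.ne, h2 j hj, h2' j (by omega)]
    · simp [Mem.set, ha, h3, h3']
  | sub e f ihe ihf =>
    intro d
    refine ((ihe d).seq ((ihf (d + 1)).seq (Polytime.write _ _ _ (by norm_num)))).mono ?_
    rintro m m' - ⟨m₁, h0, ⟨h1, h2, h3⟩, m₂, h0', ⟨h1', h2', h3'⟩, rfl⟩
    rw [hw _ _ h3, h0, h3 _ (by norm_num)] at h1'
    refine ⟨by simp [Mem.set, Expr.eval, eval, h1, h1', h2' d], fun j hj => ?_, fun a ha => ?_⟩
    · simp [Mem.set, Expr.eval, hj.ne, h2 j hj, h2' j (by omega)]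
    · simp [Mem.set, ha, h3, h3']
  | ite c e f ihc ihe ihf =>
    intro d
    refine ((ihc d).seq ((ihe d).ite (ihf d))).mono ?_
    rintro m m' - ⟨m₁, h0, ⟨h1, h2, h3⟩, h⟩
    simp only [Expr.eval, h1, hw _ _ h3, h0, h3 3 (by norm_num)] at h
    simp only [eval]
    split_ifs at h ⊢ with hc
    · exact ⟨h.1, fun j hj => (h.2.1 j hj).trans (h2 j hj),
        fun a ha => (h.2.2 a ha).trans (h3 a ha)⟩
    · exact ⟨h.1, fun j hj => (h.2.1 j hj).trans (h2 j hj),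
        fun a ha => (h.2.2 a ha).trans (h3 a ha)⟩
  | sum x e ih =>
    intro d
    have hinit := (Polytime.write 2 (.const d) (.const 0) (by norm_num)).seq
      ((Polytime.write 2 (.const (d + 1)) (.read 3 (.const x)) (by norm_num)).seq
        (Polytime.write 3 (.const x) (.const 0) (by norm_num)))
    have hbody := (ih (d + 2)).seq
      ((Polytime.write 2 (.const d) (.add (top d) (top (d + 2))) (by norm_num)).seq
        (Polytime.write 3 (.const x) (.add (.read 3 (.const x)) (.const 1)) (by norm_num)))
    have hloop := hinit.init_loop (e := .sub (.read 0 (.const 0)) (.read 3 (.const x))) hbody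
      (fun m₀ i m => m 2 d = ∑ k ∈ Finset.range i,
          e.eval (m₀ 0) (work m₀) (Function.update (m₀ 3) x k) ∧
        m 2 (d + 1) = m₀ 3 x ∧ (∀ j < d, m 2 j = m₀ 2 j) ∧
        m 3 = Function.update (m₀ 3) x i ∧ ∀ a ≠ 2, a ≠ 3 → m a = m₀ a)
      (by
        rintro m₀ m - ⟨m₁, -, rfl, m₂, -, rfl, rfl⟩
        refine ⟨by simp [Mem.set, Expr.eval], by simp [Mem.set, Expr.eval], fun j hj => ?_,
          by simp [Mem.set, Expr.eval], fun a ha ha' => by simp [Mem.set, ha, ha']⟩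
        have : j ≠ d + 1 := by omega
        simp [Mem.set, Expr.eval, hj.ne, this])
      (by
        rintro m₀ i m hm ⟨-, -, -, h, -⟩
        simp [Expr.eval, h, hm])
      (by
        rintro m₀ i m m' hm - hi ⟨h1, h2, h3, h4, h5⟩ ⟨m₁, h0, ⟨g1, g2, g3⟩, m₂, -, rfl, rfl⟩
        have hwm : work m = work m₀ := funext fun a => h5 _ (arr_ne_two a) (arr_ne_three a)
        rw [hm, hwm, h4] at g1
        refine ⟨?_, ?_, fun j hj => ?_, ?_, fun a ha ha' => ?_⟩
        · simp [Mem.set, Expr.eval, g1, g2 d, h1, Finset.sum_range_succ]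
        · simp [Mem.set, Expr.eval, g2 (d + 1), h2]
        · simp [Mem.set, Expr.eval, hj.ne, g2 j (by omega), h3 j hj]
        · simp [Mem.set, Expr.eval, g3 3, h4]
        · simp [Mem.set, ha, ha', g3 a ha, h5 a ha ha'])
    refine (hloop.seq (Polytime.write 3 (.const x) (top (d + 1)) (by norm_num))).mono ?_
    rintro m m' - ⟨m₁, h0, ⟨h1, h2, h3, h4, h5⟩, rfl⟩
    refine ⟨by simp [Mem.set, Expr.eval, eval, h1], fun j hj => by simp [Mem.set, h3 j hj],
      fun a ha => ?_⟩
    by_cases ha' : a = 3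
    · subst ha'; simp [Mem.set, Expr.eval, h4, h2]
    · simp [Mem.set, ha', h5 a ha ha']

/-- All loops have `n` iterations and no command can change `n`, so the time bounds compose by
induction on the command. -/
theorem Cmd.compile_spec (c : Cmd) : ∀ d, Polytime (c.compile d) (fun m m' =>
    work m' = c.denote (m 0) (m 3) (work m) ∧ (∀ j < d, m' 2 j = m 2 j) ∧ m' 3 = m 3) := by
  have hw : ∀ m m' : Mem, (∀ a ≠ 2, m' a = m a) → work m' = work m := fun m m' h =>
    funext fun a => h _ (arr_ne_two a)
  induction c with
  | skip =>
    intro d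
    refine ⟨Polynomial.C 1, fun m => ⟨1, m, .skip m, by simp, rfl, rfl, by simp, rfl⟩⟩
  | write a i e =>
    intro d
    refine ((i.compile_spec d).seq ((e.compile_spec (d + 1)).seq
      (Polytime.write _ _ _ (arr_ne_zero a)))).mono ?_
    rintro m m' - ⟨m₁, h0, ⟨h1, h2, h3⟩, m₂, h0', ⟨h1', h2', h3'⟩, rfl⟩
    rw [hw _ _ h3, h0, h3 _ (by norm_num)] at h1'
    have h32 := (arr_ne_two a).symm
    have h33 := (arr_ne_three a).symm
    refine ⟨?_, fun j hj => ?_, ?_⟩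
    · funext b
      by_cases hb : b = a
      · subst hb
        simp [work, Mem.set, Expr.eval, denote, h1', h2' d, h1, h3' _ (arr_ne_two _),
          h3 _ (arr_ne_two _)]
      · have : arr b ≠ arr a := fun h => hb (arr_injective h)
        simp [work, Mem.set, this, denote, hb, h3' _ (arr_ne_two _), h3 _ (arr_ne_two _)]
    · simp [Mem.set, h32, h2' j (by omega), h2 j hj]
    · simp [Mem.set, h33, h3', h3]
  | seq p q ihp ihq =>
    intro d
    refine ((ihp d).seq (ihq d)).mono ?_
    rintro m m' - ⟨m₁, h0, ⟨h1, h2, h3⟩, h1', h2', h3'⟩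
    refine ⟨?_, fun j hj => (h2' j hj).trans (h2 j hj), h3'.trans h3⟩
    rw [h1', h0, h3, h1]; rfl
  | ite c p q ihp ihq =>
    intro d
    refine ((c.compile_spec d).seq ((ihp d).ite (ihq d))).mono ?_
    rintro m m' - ⟨m₁, h0, ⟨h1, h2, h3⟩, h⟩
    simp only [Expr.eval, h1, hw _ _ h3, h0, h3 3 (by norm_num)] at h
    simp only [denote]
    split_ifs at h ⊢ with hc
    · exact ⟨h.1, fun j hj => (h.2.1 j hj).trans (h2 j hj), h.2.2⟩
    · exact ⟨h.1, fun j hj => (h.2.1 j hj).trans (h2 j hj), h.2.2⟩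
  | iter x p ih =>
    intro d
    have hinit := (Polytime.write 2 (.const d) (.read 3 (.const x)) (by norm_num)).seq
        (Polytime.write 3 (.const x) (.const 0) (by norm_num))
    have hbody := (ih (d + 1)).seq
        (Polytime.write 3 (.const x) (.add (.read 3 (.const x)) (.const 1)) (by norm_num))
    have hloop := hinit.init_loop (e := .sub (.read 0 (.const 0)) (.read 3 (.const x))) hbody
      (fun m₀ i m => work m = Nat.rec (work m₀)
          (fun i S => p.denote (m₀ 0) (Function.update (m₀ 3) x i) S) i ∧
        m 2 d = m₀ 3 x ∧ (∀ j < d, m 2 j = m₀ 2 j) ∧ m 3 = Function.update (m₀ 3) x i)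
      (by
        rintro m₀ m - ⟨m₁, -, rfl, rfl⟩
        refine ⟨?_, by simp [Mem.set, Expr.eval], fun j hj => ?_,
          by simp [Mem.set, Expr.eval]⟩
        · funext a
          simp [work, Mem.set, arr_ne_two, arr_ne_three]
        · simp [Mem.set, Expr.eval, hj.ne])
      (by
        rintro m₀ i m hm ⟨-, -, -, h⟩
        simp [Expr.eval, h, hm])
      (by
        rintro m₀ i m m' hm - hi ⟨h1, h2, h3, h4⟩ ⟨m₁, h0, ⟨g1, g2, g3⟩, rfl⟩
        rw [hm, h4] at g1
        refine ⟨?_, ?_, fun j hj => ?_, ?_⟩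
        · rw [show work (Mem.set m₁ 3 (Expr.eval m₁ (.const x))
            (Expr.eval m₁ ((Expr.read 3 (Expr.const x)).add (Expr.const 1)))) = work m₁ by
              funext a; simp [work, Mem.set, arr_ne_three], g1, h1]
        · simp [Mem.set, g2 d, h2]
        · simp [Mem.set, g2 j (by omega), h3 j hj]
        · simp [Mem.set, Expr.eval, g3, h4])
    refine (hloop.seq (Polytime.write 3 (.const x) (top d) (by norm_num))).mono ?_
    rintro m m' - ⟨m₁, h0, ⟨h1, h2, h3, h4⟩, rfl⟩
    refine ⟨?_, fun j hj => by simp [Mem.set, h3 j hj], by simp [Mem.set, Expr.eval, h4, h2]⟩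
    rw [show work (Mem.set m₁ 3 (Expr.eval m₁ (.const x)) (Expr.eval m₁ (top d))) = work m₁ by
      funext a; simp [work, Mem.set, arr_ne_three], h1]
    rfl

/-- In binary, `n` itself takes only logarithmically many bits. It is bounded through the number of
entries, each of which contributes at least one bit. -/
theorem head_le_inputSize (n : ℕ) (l : List ℕ) (h : n ≤ l.length) : n ≤ inputSize (n :: l) := by
  have : ∀ l : List ℕ, l.length ≤ inputSize l := by
    intro l
    induction l with
    | nil => simp [inputSize]
    | cons a l ih => simp only [inputSize, List.map_cons, List.sum_cons, List.length_cons] at *; omega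
  exact h.trans ((Nat.le_succ _).trans (this (n :: l)))

theorem PolyTimeComputable.of_cmd {α β : Type*} {encα : α → List ℕ} {encβ : β → List ℕ} {f : α → β}
    (hα : ∀ x, arrayOf (encα x) 0 ≤ inputSize (encα x)) (c : Cmd)
    (hc : ∀ x, c.denote (arrayOf (encα x)) (fun _ => 0) (fun _ _ => 0) 0 = arrayOf (encβ (f x))) :
    PolyTimeComputable encα encβ f := by
  obtain ⟨p, hp⟩ := c.compile_spec 0
  refine ⟨c.compile 0, p, fun x => ?_⟩
  obtain ⟨t, m, h1, h2, -, h3, -⟩ := hp (initMem (encα x))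
  refine ⟨t, m, h1, h2.trans ?_, ?_⟩
  · have hx : initMem (encα x) 0 0 ≤ inputSize (encα x) := by simpa [initMem] using hα x
    -- A polynomial with natural coefficients is monotone, so a bound in terms of `n` is one in
    -- terms of the input size.
    simp only [Polynomial.eval_eq_sum, Polynomial.sum]
    gcongr
  · have hw : work (initMem (encα x)) = fun _ _ => 0 := by
      funext a; simp [work, initMem, arr_ne_zero]
    rw [hw] at h3
    rw [← hc]
    exact congrFun h3 0

end RAM

/-! ## Cycles and packings of cycles -/

namespace Digraph

variable {V W : Type*}

theorem mem_of_mem_cycleArcs {c : List V} {e : V × V} (h : e ∈ cycleArcs c) :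
    e.1 ∈ c ∧ e.2 ∈ c := by
  obtain ⟨a, b⟩ := e
  have := List.of_mem_zip h
  simpa using this

theorem getElem_mem_cycleArcs (l : List V) (i : ℕ) (hi : i < l.length) :
    (l[i], l[(i + 1) % l.length]'(Nat.mod_lt _ (by omega))) ∈ cycleArcs l := by
  have h : i < (cycleArcs l).length := by simpa [cycleArcs] using hi
  have : (cycleArcs l)[i] = (l[i], l[(i + 1) % l.length]'(Nat.mod_lt _ (by omega))) := by
    simp [cycleArcs, List.getElem_rotate]
  rw [← this]
  exact List.getElem_mem h

/-- Going around the cycle from `x` reaches every vertex. With `P` the property of lying above `w`,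
this shows that a cycle that cannot come back across `w` lies entirely above `w`. -/
theorem forall_mem_of_closed {l : List V} (P : V → Prop)
    (h : ∀ e ∈ cycleArcs l, P e.1 → P e.2) {x : V} (hx : x ∈ l) (hP : P x) : ∀ y ∈ l, P y := by
  obtain ⟨i, hi, rfl⟩ := List.getElem_of_mem hx
  have key : ∀ j, P (l[(i + j) % l.length]'(Nat.mod_lt _ (by omega))) := by
    intro j
    induction j with
    | zero => simpa [Nat.mod_eq_of_lt hi] using hP
    | succ j ih =>
      have := h _ (getElem_mem_cycleArcs l _ (Nat.mod_lt (i + j) (by omega : 0 < l.length))) ih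
      simpa [Nat.add_assoc] using this
  intro y hy
  obtain ⟨k, hk, rfl⟩ := List.getElem_of_mem hy
  -- From index `i`, go on to the end of the list and then `k` steps further.
  have := key (k + (l.length - i))
  have h2 : (i + (k + (l.length - i))) % l.length = k := by
    rw [show i + (k + (l.length - i)) = k + l.length by omega, Nat.add_mod_right,
      Nat.mod_eq_of_lt hk]
  simpa [h2] using this

theorem exists_arc_of_mem {l : List V} {x : V} (hx : x ∈ l) : ∃ y, (x, y) ∈ cycleArcs l := by
  obtain ⟨i, hi, rfl⟩ := List.getElem_of_mem hx
  exact ⟨_, getElem_mem_cycleArcs l i hi⟩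

theorem cycleArcs_map (f : V → W) (c : List V) :
    cycleArcs (c.map f) = (cycleArcs c).map (Prod.map f f) := by
  simp [cycleArcs, ← List.map_rotate, List.zip_map]

theorem IsCycle.of_arcs {G H : Digraph V} {c : List V} (h : G.IsCycle c)
    (hH : ∀ e ∈ cycleArcs c, H.Adj e.1 e.2) : H.IsCycle c :=
  ⟨h.ne_nil, h.nodup, hH⟩

theorem hasArcDisjointCycles_of_card {G : Digraph V} {ι : Type*} [Fintype ι] {k : ℕ}
    (hk : k ≤ Fintype.card ι) (c : ι → List V) (hc : ∀ i, G.IsCycle (c i))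
    (hd : ∀ i j, i ≠ j → (cycleArcs (c i)).Disjoint (cycleArcs (c j))) :
    G.HasArcDisjointCycles k := by
  let f : Fin k → ι := fun i => (Fintype.equivFin ι).symm (Fin.castLE hk i)
  have hf : Function.Injective f := (Equiv.injective _).comp (Fin.castLE_injective hk)
  exact ⟨fun i => c (f i), fun i => hc _, fun i j hij => hd _ _ (hf.ne hij)⟩

theorem HasArcDisjointCycles.mono {G : Digraph V} {k l : ℕ} (h : G.HasArcDisjointCycles l)
    (hkl : k ≤ l) : G.HasArcDisjointCycles k := by
  obtain ⟨c, hc, hd⟩ := h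
  exact hasArcDisjointCycles_of_card (by simpa using hkl) c hc hd

/-- Packings of cycles do not change if the digraph is mapped injectively. -/
theorem hasArcDisjointCycles_iff_of_map {G : Digraph V} {H : Digraph W} (f : V → W)
    (hf : Function.Injective f) (hG : ∀ u v, G.Adj u v ↔ H.Adj (f u) (f v))
    (hH : ∀ x y, H.Adj x y → x ∈ Set.range f) (k : ℕ) :
    G.HasArcDisjointCycles k ↔ H.HasArcDisjointCycles k := by
  have hcyc : ∀ c, G.IsCycle c ↔ H.IsCycle (c.map f) := by
    intro c
    constructor
    · intro h
      refine ⟨by simpa using h.ne_nil, h.nodup.map hf, ?_⟩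
      rw [cycleArcs_map]
      intro e he
      obtain ⟨e', he', rfl⟩ := List.mem_map.1 he
      exact (hG _ _).1 (h.arcs_adj _ he')
    · intro h
      refine ⟨by simpa using h.ne_nil, h.nodup.of_map, fun e he => (hG _ _).2 ?_⟩
      have := h.arcs_adj (Prod.map f f e) (by rw [cycleArcs_map]; exact List.mem_map_of_mem he)
      simpa using this
  have hdis : ∀ c c' : List V, (cycleArcs (c.map f)).Disjoint (cycleArcs (c'.map f)) ↔
      (cycleArcs c).Disjoint (cycleArcs c') := by
    intro c c'
    rw [cycleArcs_map, cycleArcs_map]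
    have hf2 := hf.prodMap hf
    simp only [List.Disjoint, List.mem_map]
    constructor
    · intro h e he he'
      exact h ⟨e, he, rfl⟩ ⟨e, he', rfl⟩
    · rintro h _ ⟨e, he, rfl⟩ ⟨e', he', h'⟩
      rw [hf2 h'] at he'
      exact h he he'
  constructor
  · rintro ⟨c, hc, hd⟩
    exact ⟨fun i => (c i).map f, fun i => (hcyc _).1 (hc i), fun i j hij => (hdis _ _).2 (hd i j hij)⟩
  · rintro ⟨c, hc, hd⟩
    have : ∀ i, ∃ c' : List V, c'.map f = c i := by
      intro i
      -- Only tails of arcs are assumed to lie in the range of `f`; on a cycle every vertex is the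
      -- tail of an arc.
      have : c i ∈ Set.range (List.map f) := by
        rw [Set.range_list_map]
        intro x hx
        obtain ⟨y, hy⟩ := exists_arc_of_mem hx
        exact hH _ _ ((hc i).arcs_adj _ hy)
      exact this
    choose c' hc' using this
    refine ⟨c', fun i => (hcyc _).2 (by rw [hc']; exact hc i), fun i j hij => (hdis _ _).1 ?_⟩
    rw [hc', hc']
    exact hd i j hij

theorem cycleArcs_triangle (a b c : V) : cycleArcs [a, b, c] = [(a, b), (b, c), (c, a)] := rfl

theorem isCycle_triangle {G : Digraph V} (hG : ∀ u, ¬ G.Adj u u) {a b c : V} (hab : G.Adj a b)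
    (hbc : G.Adj b c) (hca : G.Adj c a) : G.IsCycle [a, b, c] := by
  refine ⟨by simp, ?_, ?_⟩
  · have h1 : a ≠ b := by rintro rfl; exact hG _ hab
    have h2 : b ≠ c := by rintro rfl; exact hG _ hbc
    have h3 : a ≠ c := by rintro rfl; exact hG _ hca
    simp [h1, h2, h3]
  · simp [cycleArcs_triangle, hab, hbc, hca]

/-! ### Packings of triangles -/

/-- `X` is the set of arcs of `t` pairwise arc-disjoint triangles of `G`. -/
inductive TrianglePacking [DecidableEq V] (G : Digraph V) : Finset (V × V) → ℕ → Prop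
  | empty : TrianglePacking G ∅ 0
  | insert {X : Finset (V × V)} {t : ℕ} {a b c : V} : TrianglePacking G X t → G.Adj a b →
      G.Adj b c → G.Adj c a → (a, b) ∉ X → (b, c) ∉ X → (c, a) ∉ X →
      TrianglePacking G (X ∪ {(a, b), (b, c), (c, a)}) (t + 1)

namespace TrianglePacking

variable [DecidableEq V] {G : Digraph V} {X : Finset (V × V)} {t : ℕ}

theorem adj (h : TrianglePacking G X t) : ∀ e ∈ X, G.Adj e.1 e.2 := by
  induction h with
  | empty => simp
  | insert h hab hbc hca _ _ _ ih =>
    intro e he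
    simp only [Finset.mem_union, Finset.mem_insert, Finset.mem_singleton] at he
    rcases he with he | rfl | rfl | rfl
    exacts [ih e he, hab, hbc, hca]

theorem card_le (h : TrianglePacking G X t) : X.card ≤ 3 * t := by
  induction h with
  | empty => simp
  | insert h _ _ _ _ _ _ ih =>
    exact (Finset.card_union_le _ _).trans (Nat.add_le_add ih Finset.card_le_three)

/-- Positions cannot strictly decrease along all three arcs of a triangle. -/
theorem card_backward_le (h : TrianglePacking G X t) (pos : V → ℕ) :
    (X.filter fun e => pos e.2 < pos e.1).card ≤ 2 * t := by
  induction h with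
  | empty => simp
  | @insert X t a b c h _ _ _ _ _ _ ih =>
    rw [Finset.filter_union]
    refine (Finset.card_union_le _ _).trans ?_
    have : (Finset.filter (fun e => pos e.2 < pos e.1)
        ({(a, b), (b, c), (c, a)} : Finset (V × V))).card ≤ 2 := by
      by_cases h1 : pos b < pos a
      · by_cases h2 : pos c < pos b
        · have h3 : ¬ pos a < pos c := by omega
          refine (Finset.card_le_card (t := {(a, b), (b, c)}) ?_).trans Finset.card_le_two
          intro e he
          simp only [Finset.mem_filter, Finset.mem_insert, Finset.mem_singleton] at he ⊢
          rcases he with ⟨rfl | rfl | rfl, he⟩ <;> simp_all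
        · refine (Finset.card_le_card (t := {(a, b), (c, a)}) ?_).trans Finset.card_le_two
          intro e he
          simp only [Finset.mem_filter, Finset.mem_insert, Finset.mem_singleton] at he ⊢
          rcases he with ⟨rfl | rfl | rfl, he⟩ <;> simp_all
      · refine (Finset.card_le_card (t := {(b, c), (c, a)}) ?_).trans Finset.card_le_two
        intro e he
        simp only [Finset.mem_filter, Finset.mem_insert, Finset.mem_singleton] at he ⊢
        rcases he with ⟨rfl | rfl | rfl, he⟩ <;> simp_all
    omega

theorem exists_cycles (h : TrianglePacking G X t) (hG : ∀ u, ¬ G.Adj u u) :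
    ∃ c : Fin t → List V, (∀ i, G.IsCycle (c i)) ∧ (∀ i, ∀ e ∈ cycleArcs (c i), e ∈ X) ∧
      ∀ i j, i ≠ j → (cycleArcs (c i)).Disjoint (cycleArcs (c j)) := by
  induction h with
  | empty => exact ⟨fun _ => [], fun i => i.elim0, fun i => i.elim0, fun i => i.elim0⟩
  | @insert X t a b d h hab hbc hca h1 h2 h3 ih =>
    obtain ⟨c, hc, hX, hd⟩ := ih
    have hnew : ∀ i, (cycleArcs (c i)).Disjoint (cycleArcs [a, b, d]) := by
      intro i e he he'
      have := hX i e he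
      simp only [cycleArcs_triangle, List.mem_cons, List.not_mem_nil, or_false] at he'
      rcases he' with rfl | rfl | rfl
      exacts [h1 this, h2 this, h3 this]
    refine ⟨Fin.cons [a, b, d] c, fun i => ?_, fun i => ?_, fun i j => ?_⟩
    · refine Fin.cases ?_ (fun i => ?_) i
      · exact isCycle_triangle hG hab hbc hca
      · exact hc i
    · refine Fin.cases ?_ (fun i => ?_) i
      · intro e he
        simp only [Fin.cons_zero, cycleArcs_triangle, List.mem_cons, List.not_mem_nil,
          or_false] at he
        rcases he with rfl | rfl | rfl <;> simp
      · intro e he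
        exact Finset.mem_union_left _ (hX i e he)
    · refine Fin.cases ?_ (fun i => ?_) i
      · refine Fin.cases (fun h => absurd rfl h) (fun j _ => ?_) j
        exact (hnew j).symm
      · refine Fin.cases (fun _ => hnew i) (fun j h => ?_) j
        exact hd i j (fun hij => h (by rw [hij]))

theorem hasArcDisjointCycles (h : TrianglePacking G X t) (hG : ∀ u, ¬ G.Adj u u) :
    G.HasArcDisjointCycles t := by
  obtain ⟨c, hc, -, hd⟩ := h.exists_cycles hG
  exact ⟨c, hc, hd⟩

end TrianglePacking

end Digraph

/-! ## Vertex orderings with few backward arcs -/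

namespace Digraph

open Classical in
/-- The pairs of `s` that are ordered by `lab` and joined by a backward arc. -/
noncomputable def backwardPairs {V : Type*} (s : Finset V) (D : V → V → Prop) (lab : V → ℕ) :
    Finset (V × V) :=
  (s ×ˢ s).filter fun e => lab e.1 < lab e.2 ∧ D e.2 e.1

open Classical in
/-- The pairs of `s` that are ordered by `lab` and not joined by an arc. -/
noncomputable def missingPairs {V : Type*} (s : Finset V) (D : V → V → Prop) (lab : V → ℕ) :
    Finset (V × V) :=
  (s ×ˢ s).filter fun e => lab e.1 < lab e.2 ∧ ¬ D e.1 e.2 ∧ ¬ D e.2 e.1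

/-- `a → b → c` is an induced path in a class of `lab`. -/
def InducedPath {V : Type*} (D : V → V → Prop) (lab : V → ℕ) (a b c : V) : Prop :=
  lab a = lab b ∧ lab b = lab c ∧ D a b ∧ D b c ∧ a ≠ c ∧ ¬ D a c ∧ ¬ D c a

open Classical in
/-- The induced paths that start in `v`. -/
noncomputable def pathsFrom {V : Type*} (s : Finset V) (D : V → V → Prop) (lab : V → ℕ) (v : V) :
    Finset (V × V) :=
  (s ×ˢ s).filter fun e => InducedPath D lab v e.1 e.2

open Classical in
/-- The induced paths with midpoint `v`. -/
noncomputable def pathsThrough {V : Type*} (s : Finset V) (D : V → V → Prop) (lab : V → ℕ)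
    (v : V) : Finset (V × V) :=
  (s ×ˢ s).filter fun e => InducedPath D lab e.1 v e.2

open Classical in
/-- The class of `v` is split into its out-neighbours (last), `v`, and the rest (first). -/
noncomputable def splitLabel {V : Type*} (D : V → V → Prop) (lab : V → ℕ) (v u : V) : ℕ :=
  -- The factor 3 makes room for three parts of a class without disturbing the order of the classes.
  3 * lab u + if lab u = lab v then (if u = v then 1 else if D v u then 2 else 0) else 0

section

variable {V : Type*} {s : Finset V} {D : V → V → Prop} {lab : V → ℕ}

theorem mem_backwardPairs {a b : V} : (a, b) ∈ backwardPairs s D lab ↔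
    (a ∈ s ∧ b ∈ s) ∧ lab a < lab b ∧ D b a := by
  classical
  simp [backwardPairs]

theorem mem_missingPairs {a b : V} : (a, b) ∈ missingPairs s D lab ↔
    (a ∈ s ∧ b ∈ s) ∧ lab a < lab b ∧ ¬ D a b ∧ ¬ D b a := by
  classical
  simp [missingPairs]

theorem mem_pathsFrom {v a b : V} : (a, b) ∈ pathsFrom s D lab v ↔
    (a ∈ s ∧ b ∈ s) ∧ InducedPath D lab v a b := by
  classical
  simp [pathsFrom]

theorem mem_pathsThrough {v a b : V} : (a, b) ∈ pathsThrough s D lab v ↔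
    (a ∈ s ∧ b ∈ s) ∧ InducedPath D lab a v b := by
  classical
  simp [pathsThrough]

theorem lt_splitLabel {v a b : V} (h : lab a < lab b) :
    splitLabel D lab v a < splitLabel D lab v b := by
  unfold splitLabel
  split_ifs <;> omega

theorem eq_of_splitLabel_eq {v a : V} (h : splitLabel D lab v a = splitLabel D lab v v) :
    a = v := by
  by_contra hne
  simp only [splitLabel, if_true, hne, if_false] at h
  split_ifs at h <;> omega

theorem lab_eq_of_splitLabel_eq {v a b : V} (h : splitLabel D lab v a = splitLabel D lab v b) :
    lab a = lab b := by
  unfold splitLabel at h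
  split_ifs at h <;> omega

/-- Inside the class of `v`, an arc becomes backward only if it leads from an out-neighbour `b` of
`v` to some `a ≠ v` that is not an out-neighbour. Since `a → v` would close a triangle, `v → b → a`
is induced. Conversely, the ends of an induced path with midpoint `v` are separated in the right
order and become a counted missing pair. -/
theorem card_backwardPairs_splitLabel_le (irrefl : ∀ a, ¬ D a a) (asymm : ∀ a b, D a b → ¬ D b a)
    (tri : ∀ a b c, D a b → D b c → ¬ D c a) {v : V}
    (hv : (pathsFrom s D lab v).card ≤ (pathsThrough s D lab v).card)
    (h : (backwardPairs s D lab).card ≤ (missingPairs s D lab).card) :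
    (backwardPairs s D (splitLabel D lab v)).card ≤
      (missingPairs s D (splitLabel D lab v)).card := by
  classical
  have h1 : backwardPairs s D (splitLabel D lab v) ⊆
      backwardPairs s D lab ∪ (pathsFrom s D lab v).image Prod.swap := by
    rintro ⟨a, b⟩ hab
    simp only [mem_backwardPairs, mem_pathsFrom, InducedPath, Finset.mem_union,
      Finset.mem_image, Prod.exists, Prod.swap_prod_mk, Prod.mk.injEq] at hab ⊢
    obtain ⟨⟨ha, hb⟩, hlt, hD⟩ := hab
    by_cases hl : lab a < lab b
    · exact Or.inl ⟨⟨ha, hb⟩, hl, hD⟩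
    · right
      have hle : lab a = lab b := by
        rcases lt_trichotomy (lab a) (lab b) with h | h | h
        · exact absurd h hl
        · exact h
        · exact absurd (lt_splitLabel (D := D) (v := v) h) (by omega)
      refine ⟨b, a, ⟨⟨hb, ha⟩, ?_⟩, rfl, rfl⟩
      unfold splitLabel at hlt
      rw [← hle] at hlt
      by_cases hlv : lab a = lab v
      · simp only [hlv, if_true] at hlt
        by_cases hav : a = v
        · subst hav
          rw [if_pos rfl] at hlt
          split_ifs at hlt with h3 h4
          · omega
          · exact absurd hD (asymm _ _ h4)
          · omega
        · rw [if_neg hav] at hlt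
          have hva : ¬ D v a := by
            intro hva
            rw [if_pos hva] at hlt
            split_ifs at hlt <;> omega
          rw [if_neg hva] at hlt
          by_cases hbv : b = v
          · subst hbv
            exact absurd hD hva
          · rw [if_neg hbv] at hlt
            have hvb : D v b := by
              by_contra hvb
              rw [if_neg hvb] at hlt
              omega
            exact ⟨by omega, hle.symm, hvb, hD, Ne.symm hav, hva, fun hav' => tri _ _ _ hvb hD hav'⟩
      · simp [hlv] at hlt
  have h2 : missingPairs s D lab ∪ pathsThrough s D lab v ⊆
      missingPairs s D (splitLabel D lab v) := by
    rintro ⟨a, b⟩ hab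
    simp only [mem_missingPairs, mem_pathsThrough, InducedPath, Finset.mem_union] at hab ⊢
    rcases hab with ⟨hs, hlt, hD⟩ | ⟨hs, hav, hvb, hDa, hDb, -, hD⟩
    · exact ⟨hs, lt_splitLabel hlt, hD⟩
    · refine ⟨hs, ?_, hD⟩
      have h3 : a ≠ v := by rintro rfl; exact irrefl _ hDa
      have h4 : b ≠ v := by rintro rfl; exact irrefl _ hDb
      simp [splitLabel, hav, hvb, h3, h4, hDb, asymm _ _ hDa]
  have h3 : Disjoint (missingPairs s D lab) (pathsThrough s D lab v) := by
    rw [Finset.disjoint_left]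
    rintro ⟨a, b⟩ ha hb
    have h1 := (mem_missingPairs.1 ha).2.1
    obtain ⟨-, h2, h3, -⟩ := mem_pathsThrough.1 hb
    omega
  calc _ ≤ _ := Finset.card_le_card h1
    _ ≤ _ := Finset.card_union_le _ _
    _ ≤ (backwardPairs s D lab).card + (pathsFrom s D lab v).card :=
        Nat.add_le_add_left Finset.card_image_le _
    _ ≤ (missingPairs s D lab).card + (pathsThrough s D lab v).card := Nat.add_le_add h hv
    _ = _ := (Finset.card_union_of_disjoint h3).symm
    _ ≤ _ := Finset.card_le_card h2

/-- Both sides count all induced paths, by first vertex and by midpoint. -/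
theorem sum_card_pathsFrom (s : Finset V) (D : V → V → Prop) (lab : V → ℕ) :
    ∑ v ∈ s, (pathsFrom s D lab v).card = ∑ v ∈ s, (pathsThrough s D lab v).card := by
  classical
  simp only [pathsFrom, pathsThrough, Finset.card_filter, Finset.sum_product]
  rw [Finset.sum_comm]

/-- If not all classes of `lab` are singletons, then a class can be split without loss. -/
theorem exists_pivot (irrefl : ∀ a, ¬ D a a) (P : V → Prop)
    (hP : ∀ v ∈ s, P v → ∀ u ∈ s, lab u = lab v → u = v) (hex : ∃ v ∈ s, ¬ P v) :
    ∃ v ∈ s, ¬ P v ∧ (pathsFrom s D lab v).card ≤ (pathsThrough s D lab v).card := by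
  by_contra! hcon
  -- Otherwise every vertex outside `P` is a start more often than a midpoint, while a vertex in
  -- `P`, alone in its class, is never a midpoint. This contradicts the double count.
  refine absurd (sum_card_pathsFrom s D lab) (ne_of_gt (Finset.sum_lt_sum (fun v hv => ?_) ?_))
  · by_cases hPv : P v
    · have : pathsThrough s D lab v = ∅ := by
        classical
        refine Finset.filter_false_of_mem ?_
        rintro ⟨a, b⟩ hab ⟨h1, h2, h3, -⟩
        rw [Finset.mem_product] at hab
        rw [hP v hv hPv a hab.1 h1] at h3
        exact irrefl _ h3
      simp [this]
    · exact (hcon v hv hPv).le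
  · obtain ⟨v, hv, hPv⟩ := hex
    exact ⟨v, hv, hcon v hv hPv⟩

/-- If the arcs outside `X` have at most as many backward arcs as missing pairs, then a tournament
has few backward arcs. -/
theorem TrianglePacking.card_backwardPairs_le [DecidableEq V] {G : Digraph V} {X : Finset (V × V)}
    {t : ℕ} (hX : TrianglePacking G X t) (hG : ∀ u ∈ s, ∀ v ∈ s, u ≠ v → G.Adj u v ∨ G.Adj v u)
    (h : (backwardPairs s (fun u v => G.Adj u v ∧ (u, v) ∉ X) lab).card ≤
      (missingPairs s (fun u v => G.Adj u v ∧ (u, v) ∉ X) lab).card) :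
    (backwardPairs s G.Adj lab).card ≤ 5 * t := by
  classical
  -- A missing pair is joined in the tournament by an arc of `X`, in one direction or the other.
  -- Missing pairs are ordered by `lab`, so different pairs give different arcs.
  have h1 : (missingPairs s (fun u v => G.Adj u v ∧ (u, v) ∉ X) lab).card ≤ X.card := by
    refine Finset.card_le_card_of_injOn (fun e => if e ∈ X then e else e.swap) ?_ ?_
    · rintro ⟨a, b⟩ hab
      rw [Finset.mem_coe, mem_missingPairs] at hab
      obtain ⟨⟨ha, hb⟩, hlt, h1, h2⟩ := hab
      have hne : a ≠ b := by rintro rfl; omega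
      by_cases hm : (a, b) ∈ X
      · simp [hm]
      · simp only [hm, if_false, Prod.swap_prod_mk, Finset.mem_coe]
        rcases hG a ha b hb hne with h3 | h3
        · exact absurd ⟨h3, hm⟩ h1
        · by_contra hm'
          exact h2 ⟨h3, hm'⟩
    · rintro ⟨a, b⟩ hab ⟨c, d⟩ hcd heq
      rw [Finset.mem_coe, mem_missingPairs] at hab hcd
      simp only at heq
      split_ifs at heq
      · exact heq
      · simp only [Prod.swap_prod_mk, Prod.mk.injEq] at heq
        obtain ⟨rfl, rfl⟩ := heq
        omega
      · simp only [Prod.swap_prod_mk, Prod.mk.injEq] at heq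
        obtain ⟨rfl, rfl⟩ := heq
        omega
      · exact Prod.swap_injective heq
  -- Backward arcs outside `X` number at most `|X| ≤ 3t` by `h` and `h1`; those in `X` number at
  -- most `2t`.
  have h2 : backwardPairs s G.Adj lab ⊆
      backwardPairs s (fun u v => G.Adj u v ∧ (u, v) ∉ X) lab ∪
        (X.filter fun e => lab e.2 < lab e.1).image Prod.swap := by
    rintro ⟨a, b⟩ hab
    simp only [mem_backwardPairs, Finset.mem_filter, Finset.mem_union, Finset.mem_image,
      Prod.exists, Prod.swap_prod_mk, Prod.mk.injEq] at hab ⊢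
    by_cases hm : (b, a) ∈ X
    · exact Or.inr ⟨b, a, ⟨hm, hab.2.1⟩, rfl, rfl⟩
    · exact Or.inl ⟨hab.1, hab.2.1, hab.2.2, hm⟩
  have h3 := hX.card_le
  have h4 := hX.card_backward_le lab
  have h5 := (Finset.card_le_card h2).trans (Finset.card_union_le _ _)
  have h6 := Finset.card_image_le (s := X.filter fun e => lab e.2 < lab e.1) (f := Prod.swap)
  omega

end

end Digraph

/-! ## Reduction of a tournament with an ordering of its vertices -/

namespace Digraph

/-- `G` is a tournament on the vertices `0, …, n - 1`. -/
structure IsTournamentOn (G : Digraph ℕ) (n : ℕ) : Prop where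
  adj_lt : ∀ u v, G.Adj u v → u < n ∧ v < n
  irrefl : ∀ u, ¬ G.Adj u u
  asymm : ∀ u v, G.Adj u v → ¬ G.Adj v u
  total : ∀ u < n, ∀ v < n, u ≠ v → G.Adj u v ∨ G.Adj v u

open Classical in
/-- The pairs `a < b` joined by a backward arc. -/
noncomputable def backArcs (G : Digraph ℕ) (n : ℕ) : Finset (ℕ × ℕ) :=
  (Finset.range n ×ˢ Finset.range n).filter fun e => e.1 < e.2 ∧ G.Adj e.2 e.1

open Classical in
/-- The vertices that are in no backward arc. -/
noncomputable def unaffected (G : Digraph ℕ) (n : ℕ) : Finset ℕ :=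
  (Finset.range n).filter fun w => ∀ e ∈ G.backArcs n, w ≠ e.1 ∧ w ≠ e.2

/-- Some vertex of `S` lies between `a` and `b`. -/
def Spans (S : Finset ℕ) (a b : ℕ) : Prop := ∃ w ∈ S, a < w ∧ w < b

open Classical in
/-- The backward arcs that span a vertex of `S`. -/
noncomputable def spanning (G : Digraph ℕ) (n : ℕ) (S : Finset ℕ) : Finset (ℕ × ℕ) :=
  (G.backArcs n).filter fun e => Spans S e.1 e.2

/-- `S` is a set of unaffected vertices that maximizes the difference of the number of vertices and
the number of backward arcs that span a vertex. -/
structure IsOptimal (G : Digraph ℕ) (n : ℕ) (S : Finset ℕ) : Prop where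
  subset : S ⊆ G.unaffected n
  le : ∀ S' ⊆ G.unaffected n, S'.card + (G.spanning n S).card ≤ S.card + (G.spanning n S').card

/-- The vertices of `S` are deleted, and the backward arcs that span a vertex of `S` reversed. -/
def reduce (G : Digraph ℕ) (n : ℕ) (S : Finset ℕ) : Digraph ℕ where
  Adj u v := (u < n ∧ v < n) ∧ (u ∉ S ∧ v ∉ S) ∧
    (u < v ∧ (G.Adj u v ∨ Spans S u v) ∨ v < u ∧ G.Adj u v ∧ ¬ Spans S v u)

variable {G : Digraph ℕ} {n : ℕ} {S : Finset ℕ}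

theorem mem_backArcs (hG : G.IsTournamentOn n) {a b : ℕ} :
    (a, b) ∈ G.backArcs n ↔ a < b ∧ G.Adj b a := by
  simp only [backArcs, Finset.mem_filter, Finset.mem_product, Finset.mem_range,
    and_iff_right_iff_imp]
  exact fun h => (hG.adj_lt _ _ h.2).symm

theorem mem_unaffected_ne {w a b : ℕ} (hw : w ∈ G.unaffected n) (h : (a, b) ∈ G.backArcs n) :
    w ≠ a ∧ w ≠ b := by
  classical
  exact (Finset.mem_filter.1 hw).2 _ h

/-- The arcs joining `w` to `a` and `b` are not backward, as `w` is unaffected. Together with the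
backward arc they form a triangle. -/
theorem IsTournamentOn.adj_of_lt_of_mem (hG : G.IsTournamentOn n) {a w b : ℕ}
    (hw : w ∈ G.unaffected n) (h : (a, b) ∈ G.backArcs n) (h1 : a < w) (h2 : w < b) :
    G.Adj a w ∧ G.Adj w b := by
  have hab := (mem_backArcs hG).1 h
  have hb := hG.adj_lt _ _ hab.2
  constructor
  · refine (hG.total a (by omega) w (by omega) (by omega)).resolve_right fun hwa => ?_
    exact (mem_unaffected_ne hw ((mem_backArcs hG).2 ⟨h1, hwa⟩)).2 rfl
  · refine (hG.total w (by omega) b (by omega) (by omega)).resolve_right fun hwa => ?_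
    exact (mem_unaffected_ne hw ((mem_backArcs hG).2 ⟨h2, hwa⟩)).1 rfl

/-! ### Triangles from matchings of backward arcs and unaffected vertices -/

section matching

variable {ι : Type*} {e : ι → ℕ × ℕ} {w : ι → ℕ}

theorem isCycle_of_span (hG : G.IsTournamentOn n) {e : ℕ × ℕ} {w : ℕ} (he : e ∈ G.backArcs n)
    (hw : w ∈ G.unaffected n) (h : e.1 < w ∧ w < e.2) : G.IsCycle [e.1, w, e.2] := by
  have := hG.adj_of_lt_of_mem hw he h.1 h.2
  exact isCycle_triangle hG.irrefl this.1 this.2 ((mem_backArcs hG).1 he).2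

/-- An unaffected vertex is no end of a backward arc, so the two arcs at `w i` determine `w i`, and
the third arc determines `e i`. -/
theorem disjoint_of_matching (he : ∀ i, e i ∈ G.backArcs n) (hw : ∀ i, w i ∈ G.unaffected n)
    (hei : Function.Injective e) (hwi : Function.Injective w) {i j : ι} (hij : i ≠ j) :
    (cycleArcs [(e i).1, w i, (e i).2]).Disjoint (cycleArcs [(e j).1, w j, (e j).2]) := by
  have hne : w i ≠ w j := hwi.ne hij
  have hne' : e i ≠ e j := hei.ne hij
  have h1 := mem_unaffected_ne (hw i) (he j)
  have h2 := mem_unaffected_ne (hw j) (he i)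
  intro x hx hx'
  simp only [cycleArcs_triangle, List.mem_cons, List.not_mem_nil, or_false] at hx hx'
  rcases hx with rfl | rfl | rfl <;> simp only [Prod.mk.injEq] at hx'
  · rcases hx' with h | h | h <;> omega
  · rcases hx' with h | h | h <;> omega
  · rcases hx' with h | h | h
    · omega
    · omega
    · exact hne' (Prod.ext h.2 h.1)

end matching

/-- Hall's condition: let `B` be the vertices of `S` spanned by a set `A` of spanning arcs. Removing
`B` from `S` frees all of `A`, so optimality gives `|A| ≤ |B|`. -/
theorem IsOptimal.exists_matching (h : G.IsOptimal n S) :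
    ∃ f : {e // e ∈ G.spanning n S} → ℕ, Function.Injective f ∧
      ∀ e, f e ∈ S ∧ e.1.1 < f e ∧ f e < e.1.2 := by
  classical
  have := (Finset.all_card_le_biUnion_card_iff_exists_injective
    (fun e : {e // e ∈ G.spanning n S} => S.filter fun w => e.1.1 < w ∧ w < e.1.2)).1 ?_
  · obtain ⟨f, hf, hf'⟩ := this
    exact ⟨f, hf, fun e => Finset.mem_filter.1 (hf' e)⟩
  · intro A
    set B := A.biUnion fun e => S.filter fun w => e.1.1 < w ∧ w < e.1.2 with hB
    have hBS : B ⊆ S := by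
      intro w hw
      obtain ⟨e, -, he⟩ := Finset.mem_biUnion.1 hw
      exact (Finset.mem_filter.1 he).1
    have h1 := h.le (S \ B) (Finset.sdiff_subset.trans h.subset)
    have h2 : G.spanning n (S \ B) ⊆ G.spanning n S \ A.map (Function.Embedding.subtype _) := by
      intro e he
      obtain ⟨heF, w, hw, hew⟩ := Finset.mem_filter.1 he
      rw [Finset.mem_sdiff] at hw ⊢
      refine ⟨Finset.mem_filter.2 ⟨heF, w, hw.1, hew⟩, fun hA => hw.2 ?_⟩
      obtain ⟨e', he', rfl⟩ := Finset.mem_map.1 hA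
      exact Finset.mem_biUnion.2 ⟨e', he', Finset.mem_filter.2 ⟨hw.1, hew⟩⟩
    have h3 : A.map (Function.Embedding.subtype _) ⊆ G.spanning n S := by
      intro e he
      obtain ⟨e', he', rfl⟩ := Finset.mem_map.1 he
      exact e'.2
    have h4 := Finset.card_le_card h2
    have h5 := Finset.card_le_card h3
    have h6 := Finset.card_le_card hBS
    rw [Finset.card_sdiff_of_subset h3] at h4
    rw [Finset.card_sdiff_of_subset hBS] at h1
    rw [Finset.card_map] at h4 h5
    omega

/-- Hall's condition on the other side: adding to `S` a set `A` of unaffected vertices creates only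
the new spanning arcs in `B`, so optimality gives `|A| ≤ |B|`. -/
theorem IsOptimal.exists_matching_compl (h : G.IsOptimal n S) :
    ∃ f : {w // w ∈ G.unaffected n \ S} → ℕ × ℕ, Function.Injective f ∧
      ∀ w, f w ∈ G.backArcs n \ G.spanning n S ∧ (f w).1 < w.1 ∧ w.1 < (f w).2 := by
  classical
  have := (Finset.all_card_le_biUnion_card_iff_exists_injective
    (fun w : {w // w ∈ G.unaffected n \ S} =>
      (G.backArcs n \ G.spanning n S).filter fun e => e.1 < w.1 ∧ w.1 < e.2)).1 ?_
  · obtain ⟨f, hf, hf'⟩ := this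
    exact ⟨f, hf, fun e => Finset.mem_filter.1 (hf' e)⟩
  · intro A
    set B := A.biUnion fun w =>
      (G.backArcs n \ G.spanning n S).filter fun e => e.1 < w.1 ∧ w.1 < e.2 with hB
    have hA : A.map (Function.Embedding.subtype _) ⊆ G.unaffected n \ S := by
      intro e he
      obtain ⟨e', he', rfl⟩ := Finset.mem_map.1 he
      exact e'.2
    have h1 := h.le (S ∪ A.map (Function.Embedding.subtype _))
      (Finset.union_subset h.subset (hA.trans Finset.sdiff_subset))
    have h2 : G.spanning n (S ∪ A.map (Function.Embedding.subtype _)) ⊆ G.spanning n S ∪ B := by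
      intro e he
      obtain ⟨heF, w, hw, hew⟩ := Finset.mem_filter.1 he
      rw [Finset.mem_union] at hw ⊢
      by_cases hes : e ∈ G.spanning n S
      · exact Or.inl hes
      · right
        rcases hw with hw | hw
        · exact absurd (Finset.mem_filter.2 ⟨heF, w, hw, hew⟩) hes
        · obtain ⟨w', hw', rfl⟩ := Finset.mem_map.1 hw
          exact Finset.mem_biUnion.2 ⟨w', hw', Finset.mem_filter.2
            ⟨Finset.mem_sdiff.2 ⟨heF, hes⟩, hew⟩⟩
    have h3 : Disjoint S (A.map (Function.Embedding.subtype _)) :=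
      Finset.disjoint_sdiff.mono_right hA
    have h4 := (Finset.card_le_card h2).trans (Finset.card_union_le _ _)
    rw [Finset.card_union_of_disjoint h3, Finset.card_map] at h1
    omega

/-- The number of disjoint triangles that are found by the optimal set. -/
theorem IsOptimal.hasArcDisjointCycles (h : G.IsOptimal n S) (hG : G.IsTournamentOn n) :
    G.HasArcDisjointCycles ((G.spanning n S).card + (G.unaffected n \ S).card) := by
  classical
  obtain ⟨f, hf, hf'⟩ := h.exists_matching
  obtain ⟨g, hg, hg'⟩ := h.exists_matching_compl
  let e : {e // e ∈ G.spanning n S} ⊕ {w // w ∈ G.unaffected n \ S} → ℕ × ℕ :=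
    Sum.elim (fun e => e.1) g
  let w : {e // e ∈ G.spanning n S} ⊕ {w // w ∈ G.unaffected n \ S} → ℕ :=
    Sum.elim f (fun w => w.1)
  have he : ∀ i, e i ∈ G.backArcs n := by
    rintro (i | i)
    · exact (Finset.mem_filter.1 i.2).1
    · exact (Finset.mem_sdiff.1 (hg' i).1).1
  have hw : ∀ i, w i ∈ G.unaffected n := by
    rintro (i | i)
    · exact h.subset (hf' i).1
    · exact (Finset.mem_sdiff.1 i.2).1
  have hew : ∀ i, (e i).1 < w i ∧ w i < (e i).2 := by
    rintro (i | i)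
    · exact (hf' i).2
    · exact (hg' i).2
  -- The first matching uses arcs in `G.spanning n S` and vertices in `S`, the second only arcs and
  -- vertices outside these sets, so both combine.
  have hei : Function.Injective e := Subtype.val_injective.sumElim hg fun i j hij =>
    (Finset.mem_sdiff.1 (hg' j).1).2 (hij ▸ i.2)
  have hwi : Function.Injective w := hf.sumElim Subtype.val_injective fun i j hij =>
    (Finset.mem_sdiff.1 j.2).2 (hij ▸ (hf' i).1)
  refine hasArcDisjointCycles_of_card (by simp) (fun i => [(e i).1, w i, (e i).2])
    (fun i => isCycle_of_span hG (he i) (hw i) (hew i))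
    (fun i j hij => disjoint_of_matching he hw hei hwi hij)

/-- No arc of the reduced tournament leads backward across a vertex of `S`, so its cycles use no arc
across such a vertex at all and are cycles of `G`. The matched triangles can be added: each of their
arcs meets `S` or is a spanning arc in its original direction, hence absent after the reduction. -/
theorem IsOptimal.hasArcDisjointCycles_of_reduce (h : G.IsOptimal n S) (hG : G.IsTournamentOn n)
    {k : ℕ} (hk : (G.reduce n S).HasArcDisjointCycles k) :
    G.HasArcDisjointCycles (k + (G.spanning n S).card) := by
  classical
  obtain ⟨f, hf, hf'⟩ := h.exists_matching
  obtain ⟨c, hc, hd⟩ := hk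
  have he : ∀ i : {e // e ∈ G.spanning n S}, i.1 ∈ G.backArcs n := fun i =>
    (Finset.mem_filter.1 i.2).1
  have hw : ∀ i, f i ∈ G.unaffected n := fun i => h.subset (hf' i).1
  have hadj : ∀ i, ∀ e ∈ cycleArcs (c i), G.Adj e.1 e.2 := by
    rintro i ⟨u, v⟩ he
    have huv := (hc i).arcs_adj _ he
    rcases huv.2.2 with ⟨hlt, h1 | ⟨w, hw, h1, h2⟩⟩ | ⟨-, h1, -⟩
    · exact h1
    -- Having reached `v > w`, the cycle can never return to `u < w`.
    · exfalso
      have := forall_mem_of_closed (l := c i) (fun x => w < x) ?_ (mem_of_mem_cycleArcs he).2 h2 _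
        (mem_of_mem_cycleArcs he).1
      · exact absurd this (by simpa using h1.le)
      · rintro ⟨x, y⟩ hxy hx
        have hxy := (hc i).arcs_adj _ hxy
        simp only at hx hxy ⊢
        by_contra hy
        have hyw : y ≠ w := by rintro rfl; exact hxy.2.1.2 hw
        rcases hxy.2.2 with h3 | h3
        · omega
        · exact h3.2.2 ⟨w, hw, by omega, hx⟩
    · exact h1
  have hnew : ∀ i (j : {e // e ∈ G.spanning n S}),
      (cycleArcs (c i)).Disjoint (cycleArcs [j.1.1, f j, j.1.2]) := by
    intro i j x hx hx'
    have h1 := (hc i).arcs_adj _ hx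
    simp only [cycleArcs_triangle, List.mem_cons, List.not_mem_nil, or_false] at hx'
    rcases hx' with rfl | rfl | rfl
    · exact h1.2.1.2 (hf' j).1
    · exact h1.2.1.1 (hf' j).1
    · rcases h1.2.2 with h3 | h3
      · have := (hf' j).2
        simp only at h3
        omega
      · exact h3.2.2 ⟨f j, hf' j⟩
  refine hasArcDisjointCycles_of_card (ι := Fin k ⊕ {e // e ∈ G.spanning n S}) (by simp)
    (Sum.elim c fun j => [j.1.1, f j, j.1.2]) ?_ ?_
  · rintro (i | i)
    · exact (hc i).of_arcs (hadj i)
    · exact isCycle_of_span hG (he i) (hw i) (hf' i).2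
  · rintro (i | i) (j | j) hij
    · exact hd i j (fun h => hij (by rw [h]))
    · exact hnew i j
    · exact (hnew j i).symm
    · exact disjoint_of_matching he hw Subtype.val_injective hf (fun h => hij (by rw [h]))

/-- A cycle leaves a vertex `w ∈ S` upwards, since `w` is in no backward arc, and could come back
only along a backward arc spanning `w`. Hence a cycle without spanning arcs avoids `S`. -/
theorem reduce_isCycle (hG : G.IsTournamentOn n) (hS : S ⊆ G.unaffected n) {c : List ℕ}
    (hc : G.IsCycle c) (h : ∀ e ∈ cycleArcs c, e.swap ∉ G.spanning n S) :
    (G.reduce n S).IsCycle c := by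
  classical
  have hback : ∀ u v, (u, v) ∈ cycleArcs c → v < u → (v, u) ∈ G.backArcs n := fun u v huv hlt =>
    (mem_backArcs hG).2 ⟨hlt, hc.arcs_adj _ huv⟩
  have havoid : ∀ w ∈ c, w ∉ S := by
    intro w hwc hwS
    obtain ⟨y, hy⟩ := exists_arc_of_mem hwc
    have hwy : w < y := by
      by_contra hlt
      have hne : y ≠ w := by
        rintro rfl
        exact hG.irrefl _ (hc.arcs_adj _ hy)
      exact (mem_unaffected_ne (hS hwS) (hback w y hy (by omega))).2 rfl
    have := forall_mem_of_closed (l := c) (fun x => w < x) ?_ (mem_of_mem_cycleArcs hy).2 hwy w hwc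
    · exact lt_irrefl _ this
    · rintro ⟨u, v⟩ huv hu
      simp only at hu ⊢
      by_contra hv
      have hb := hback u v huv (by omega)
      have hne := (mem_unaffected_ne (hS hwS) hb).1
      exact h _ huv (Finset.mem_filter.2 ⟨hb, w, hwS, by simp only [Prod.fst_swap]; omega, hu⟩)
  refine hc.of_arcs ?_
  rintro ⟨u, v⟩ huv
  have hadj := hc.arcs_adj _ huv
  have hm := mem_of_mem_cycleArcs huv
  refine ⟨hG.adj_lt _ _ hadj, ⟨havoid _ hm.1, havoid _ hm.2⟩, ?_⟩
  rcases lt_trichotomy u v with hlt | rfl | hlt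
  · exact Or.inl ⟨hlt, Or.inl hadj⟩
  · exact absurd hadj (hG.irrefl _)
  · exact Or.inr ⟨hlt, hadj, fun hsp => h _ huv (Finset.mem_filter.2 ⟨hback u v huv hlt, hsp⟩)⟩

/-- Only cycles containing a spanning arc are lost; by disjointness each has a spanning arc of its
own. -/
theorem reduce_hasArcDisjointCycles (hG : G.IsTournamentOn n) (hS : S ⊆ G.unaffected n)
    {k : ℕ} (hk : G.HasArcDisjointCycles (k + (G.spanning n S).card)) :
    (G.reduce n S).HasArcDisjointCycles k := by
  classical
  obtain ⟨c, hc, hd⟩ := hk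
  let P : Fin (k + (G.spanning n S).card) → Prop := fun i =>
    ∀ e ∈ cycleArcs (c i), e.swap ∉ G.spanning n S
  have hbad : Fintype.card {i // ¬ P i} ≤ (G.spanning n S).card := by
    have : ∀ i : {i // ¬ P i}, ∃ e ∈ cycleArcs (c i), e.swap ∈ G.spanning n S := by
      rintro ⟨i, hi⟩
      simpa [P] using hi
    choose e he he' using this
    refine (Fintype.card_le_of_injective (β := {e // e ∈ G.spanning n S})
      (fun i => ⟨(e i).swap, he' i⟩) fun i j hij => ?_).trans (Fintype.card_coe _).le
    have heq : e i = e j := Prod.swap_injective (congrArg Subtype.val hij)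
    by_contra hne
    exact hd i j (fun h => hne (Subtype.ext h)) (he i) (heq ▸ he j)
  have hcard := Fintype.card_subtype_compl P
  rw [Fintype.card_fin] at hcard
  have hle := Fintype.card_subtype_le P
  rw [Fintype.card_fin] at hle
  exact hasArcDisjointCycles_of_card (ι := {i // P i}) (by omega) (fun i => c i)
    (fun i => reduce_isCycle hG hS (hc i) i.2)
    (fun i j hij => hd i j (fun h => hij (Subtype.ext h)))

theorem IsOptimal.reduce_iff (h : G.IsOptimal n S) (hG : G.IsTournamentOn n) (k : ℕ) :
    G.HasArcDisjointCycles (k + (G.spanning n S).card) ↔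
      (G.reduce n S).HasArcDisjointCycles k :=
  ⟨reduce_hasArcDisjointCycles hG h.subset, h.hasArcDisjointCycles_of_reduce hG⟩

theorem card_le_of_backArcs (G : Digraph ℕ) (n : ℕ) (S : Finset ℕ) :
    (Finset.range n \ S).card ≤ 2 * (G.backArcs n).card + (G.unaffected n \ S).card := by
  classical
  have h : Finset.range n \ S ⊆ ((G.backArcs n).image Prod.fst ∪ (G.backArcs n).image Prod.snd) ∪
      (G.unaffected n \ S) := by
    intro w hw
    rw [Finset.mem_sdiff] at hw
    by_cases hu : w ∈ G.unaffected n
    · exact Finset.mem_union_right _ (Finset.mem_sdiff.2 ⟨hu, hw.2⟩)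
    · refine Finset.mem_union_left _ ?_
      simp only [unaffected, Finset.mem_filter, hw.1, true_and, not_forall] at hu
      obtain ⟨e, he, hwe⟩ := hu
      rw [Finset.mem_union, Finset.mem_image, Finset.mem_image]
      by_cases h1 : w = e.1
      · exact Or.inl ⟨e, he, h1.symm⟩
      · refine Or.inr ⟨e, he, ?_⟩
        by_contra h2
        exact hwe ⟨h1, Ne.symm h2⟩
  have h1 := (Finset.card_le_card h).trans (Finset.card_union_le _ _)
  have h2 := Finset.card_union_le ((G.backArcs n).image Prod.fst) ((G.backArcs n).image Prod.snd)
  have h3 := Finset.card_image_le (s := G.backArcs n) (f := Prod.fst)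
  have h4 := Finset.card_image_le (s := G.backArcs n) (f := Prod.snd)
  omega

end Digraph

/-! ## Optimal sets of unaffected vertices by dynamic programming -/

namespace Digraph

variable {G : Digraph ℕ} {n : ℕ}

open Classical in
/-- The number of vertices of `S` plus the number of backward arcs below `j` that span no vertex
of `S`. -/
noncomputable def prefixValue (G : Digraph ℕ) (n j : ℕ) (S : Finset ℕ) : ℕ :=
  S.card + ((G.backArcs n).filter fun e => e.2 < j ∧ ¬ Spans S e.1 e.2).card

open Classical in
/-- The backward arcs strictly between `i` and `j`. -/
noncomputable def arcsBetween (G : Digraph ℕ) (n i j : ℕ) : Finset (ℕ × ℕ) :=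
  (G.backArcs n).filter fun e => i < e.1 ∧ e.2 < j

/-- This is the recurrence of the dynamic program. As `i` is in no backward arc, an arc not spanning
`i` either ends before `i`, or starts after `i` and thus beyond all of `S`. -/
theorem prefixValue_insert (hG : G.IsTournamentOn n) {S : Finset ℕ} {i j : ℕ}
    (hS : S ⊆ Finset.range i) (hi : i ∈ G.unaffected n) (hij : i < j) :
    G.prefixValue n j (insert i S) = G.prefixValue n i S + 1 + (G.arcsBetween n i j).card := by
  classical
  have hlt : ∀ w ∈ S, w < i := fun w hw => Finset.mem_range.1 (hS hw)
  have hiS : i ∉ S := fun h => lt_irrefl _ (hlt i h)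
  have h1 : (G.backArcs n).filter (fun e => e.2 < j ∧ ¬ Spans (insert i S) e.1 e.2) =
      (G.backArcs n).filter (fun e => e.2 < i ∧ ¬ Spans S e.1 e.2) ∪ G.arcsBetween n i j := by
    ext ⟨a, b⟩
    have hs : Spans (insert i S) a b ↔ (a < i ∧ i < b) ∨ Spans S a b := by simp [Spans]
    simp only [arcsBetween, Finset.mem_union, Finset.mem_filter, hs, ← and_or_left]
    refine and_congr_right fun hF => ?_
    have hne := mem_unaffected_ne hi hF
    have hab := ((mem_backArcs hG).1 hF).1
    constructor
    · rintro ⟨hbj, hsp⟩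
      rw [not_or] at hsp
      by_cases hb : b < i
      · exact Or.inl ⟨hb, hsp.2⟩
      · exact Or.inr ⟨by omega, hbj⟩
    · rintro (⟨hb, hsp⟩ | ⟨ha, hb⟩)
      · exact ⟨by omega, not_or.2 ⟨by omega, hsp⟩⟩
      · refine ⟨hb, not_or.2 ⟨by omega, ?_⟩⟩
        rintro ⟨w, hw, h2, -⟩
        have := hlt w hw
        omega
  have h2 : Disjoint ((G.backArcs n).filter (fun e => e.2 < i ∧ ¬ Spans S e.1 e.2))
      (G.arcsBetween n i j) := by
    rw [Finset.disjoint_left]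
    rintro ⟨a, b⟩ h h'
    simp only [arcsBetween, Finset.mem_filter] at h h'
    have := ((mem_backArcs hG).1 h.1).1
    omega
  rw [prefixValue, prefixValue, h1, Finset.card_union_of_disjoint h2,
    Finset.card_insert_of_notMem hiS]
  omega

theorem prefixValue_empty (G : Digraph ℕ) (n j : ℕ) :
    G.prefixValue n j ∅ = ((G.backArcs n).filter fun e => e.2 < j).card := by
  classical
  simp [prefixValue, Spans]

/-- The set `S` has the maximal value `b` among all sets of unaffected vertices below `j`. -/
structure IsBestPrefix (G : Digraph ℕ) (n j : ℕ) (S : Finset ℕ) (b : ℕ) : Prop where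
  subset : S ⊆ G.unaffected n
  lt : S ⊆ Finset.range j
  value : G.prefixValue n j S = b
  le : ∀ S' ⊆ G.unaffected n, S' ⊆ Finset.range j → G.prefixValue n j S' ≤ b

/-- A nonempty competitor with maximum `i` arises by inserting `i` into a set below `i`, whose value
is at most `c i`. It therefore suffices to beat the empty set and one candidate for each `i`. -/
theorem isBestPrefix_of_le (hG : G.IsTournamentOn n) {j b : ℕ} {S : Finset ℕ}
    {T : ℕ → Finset ℕ} {c : ℕ → ℕ} (hT : ∀ i < j, G.IsBestPrefix n i (T i) (c i))
    (hS : S ⊆ G.unaffected n) (hSj : S ⊆ Finset.range j) (hb : G.prefixValue n j S = b)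
    (h0 : G.prefixValue n j ∅ ≤ b)
    (h1 : ∀ i ∈ G.unaffected n, i < j → c i + 1 + (G.arcsBetween n i j).card ≤ b) :
    G.IsBestPrefix n j S b := by
  classical
  refine ⟨hS, hSj, hb, fun S' hS' hj' => ?_⟩
  rcases S'.eq_empty_or_nonempty with rfl | hne
  · exact h0
  · have hmax := S'.max'_mem hne
    set i := S'.max' hne with hi
    have hij : i < j := Finset.mem_range.1 (hj' hmax)
    have hlt : S'.erase i ⊆ Finset.range i := fun w hw => by
      rw [Finset.mem_range]
      exact lt_of_le_of_ne (S'.le_max' w (Finset.mem_of_mem_erase hw)) (Finset.ne_of_mem_erase hw)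
    have h2 := (hT i hij).le (S'.erase i) ((Finset.erase_subset _ _).trans hS') hlt
    have h3 := prefixValue_insert hG hlt (hS' hmax) hij
    rw [Finset.insert_erase hmax] at h3
    have h4 := h1 i (hS' hmax) hij
    omega

/-- At `n`, the value counts the vertices of `S` and the backward arcs that do not span `S`. It thus
differs from `|S| - |G.spanning n S|` by the constant `|G.backArcs n|`. -/
theorem IsBestPrefix.isOptimal (hG : G.IsTournamentOn n) {b : ℕ} {S : Finset ℕ}
    (h : G.IsBestPrefix n n S b) : G.IsOptimal n S := by
  classical
  have hval : ∀ S', G.prefixValue n n S' + (G.spanning n S').card =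
      S'.card + (G.backArcs n).card := by
    intro S'
    have h1 : (G.backArcs n).filter (fun e => e.2 < n ∧ ¬ Spans S' e.1 e.2) =
        (G.backArcs n).filter (fun e => ¬ Spans S' e.1 e.2) := by
      refine Finset.filter_congr ?_
      rintro ⟨a, b⟩ hab
      have := (hG.adj_lt _ _ ((mem_backArcs hG).1 hab).2).1
      simp [this]
    rw [prefixValue, h1, spanning, Nat.add_assoc, Nat.add_comm (Finset.card _) (Finset.card _),
      Finset.card_filter_add_card_filter_not]
  refine ⟨h.subset, fun S' hS' => ?_⟩
  have h1 := h.le S' hS' (hS'.trans (Finset.filter_subset _ _))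
  have h2 := hval S
  have h3 := hval S'
  have h4 := h.value
  omega

end Digraph

/-! ## The encoding of an instance -/

/-- The digraph on the natural numbers encoded by an array. -/
def RAM.inputGraph (I : ℕ → ℕ) : Digraph ℕ where
  Adj u v := u < I 0 ∧ v < I 0 ∧ I (2 + (I 0 * u + v)) ≠ 0

namespace ACTInstance

theorem getD_ofFn {N : ℕ} (f : Fin N → ℕ) (q : ℕ) :
    (List.ofFn f).getD q 0 = if h : q < N then f ⟨q, h⟩ else 0 := by
  split_ifs with h
  · rw [List.getD_eq_getElem _ _ (by simpa using h)]
    simp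
  · rw [List.getD_eq_default _ _ (by simpa using h)]

theorem arrayOf_encode_matrix (J : ACTInstance) {x y : ℕ} (hx : x < J.n) (hy : y < J.n) :
    RAM.arrayOf J.encode (2 + (J.n * x + y)) ≠ 0 ↔ J.T.Adj ⟨x, hx⟩ ⟨y, hy⟩ := by
  have hq : J.n * x + y < J.n * J.n := by nlinarith
  rw [Nat.add_comm]
  simp only [RAM.arrayOf, encode, List.getD_cons_succ, getD_ofFn, hq, dif_pos]
  have h1 : (⟨J.n * x + y, hq⟩ : Fin (J.n * J.n)).divNat = ⟨x, hx⟩ := by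
    ext
    simp [Fin.divNat, Nat.mul_add_div (by omega : 0 < J.n), Nat.div_eq_of_lt hy]
  have h2 : (⟨J.n * x + y, hq⟩ : Fin (J.n * J.n)).modNat = ⟨y, hy⟩ := by
    ext
    simp [Fin.modNat, Nat.mod_eq_of_lt hy]
  rw [h1, h2]
  simp

theorem eq_arrayOf_encode (J : ACTInstance) {f : ℕ → ℕ} (h0 : f 0 = J.n) (h1 : f 1 = J.k)
    (h01 : ∀ q, f (2 + q) ≤ 1)
    (hadj : ∀ x y (hx : x < J.n) (hy : y < J.n),
      f (2 + (J.n * x + y)) ≠ 0 ↔ J.T.Adj ⟨x, hx⟩ ⟨y, hy⟩)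
    (hq : ∀ q, J.n * J.n ≤ q → f (2 + q) = 0) : f = RAM.arrayOf J.encode := by
  funext q
  match q with
  | 0 => simp [h0, RAM.arrayOf, encode]
  | 1 => simp [h1, RAM.arrayOf, encode]
  | q + 2 =>
    simp only [RAM.arrayOf, encode, List.getD_cons_succ, getD_ofFn]
    rw [Nat.add_comm]
    split_ifs with h h'
    · have hn : 0 < J.n := by
        by_contra hn
        have : J.n = 0 := by omega
        simp [this] at h
      have := (hadj (q / J.n) (q % J.n) (Nat.div_lt_of_lt_mul h) (Nat.mod_lt _ hn)).2 h'
      rw [Nat.div_add_mod] at this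
      have := h01 q
      omega
    · have hn : 0 < J.n := by
        by_contra hn
        have : J.n = 0 := by omega
        simp [this] at h
      have := mt (hadj (q / J.n) (q % J.n) (Nat.div_lt_of_lt_mul h) (Nat.mod_lt _ hn)).1 h'
      rw [Nat.div_add_mod] at this
      simpa using this
    · exact hq q (by omega)

theorem inputGraph_adj (J : ACTInstance) (u v : Fin J.n) :
    J.T.Adj u v ↔ (RAM.inputGraph (RAM.arrayOf J.encode)).Adj u v := by
  have h0 : RAM.arrayOf J.encode 0 = J.n := by simp [RAM.arrayOf, encode]
  simp only [RAM.inputGraph, h0, u.2, v.2, true_and]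
  exact (arrayOf_encode_matrix J u.2 v.2).symm

theorem isTournamentOn_inputGraph (J : ACTInstance) :
    (RAM.inputGraph (RAM.arrayOf J.encode)).IsTournamentOn J.n := by
  have h0 : RAM.arrayOf J.encode 0 = J.n := by simp [RAM.arrayOf, encode]
  have hlt : ∀ u v, (RAM.inputGraph (RAM.arrayOf J.encode)).Adj u v → u < J.n ∧ v < J.n := by
    intro u v h
    rw [← h0]
    exact ⟨h.1, h.2.1⟩
  refine ⟨hlt, fun u h => ?_, fun u v h h' => ?_, fun u hu v hv hne => ?_⟩
  · exact J.isTournament.loopless _ ((inputGraph_adj J ⟨u, (hlt _ _ h).1⟩ ⟨u, _⟩).2 h)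
  · obtain ⟨hu, hv⟩ := hlt _ _ h
    have h1 := (inputGraph_adj J ⟨u, hu⟩ ⟨v, hv⟩).2 h
    have h2 := (inputGraph_adj J ⟨v, hv⟩ ⟨u, hu⟩).2 h'
    have hne : (⟨u, hu⟩ : Fin J.n) ≠ ⟨v, hv⟩ := by
      intro heq
      rw [heq] at h1
      exact J.isTournament.loopless _ h1
    rcases J.isTournament.exactlyOne _ _ hne with h3 | h3
    · exact h3.2 h2
    · exact h3.2 h1
  · have hne : (⟨u, hu⟩ : Fin J.n) ≠ ⟨v, hv⟩ := by simpa using hne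
    rcases J.isTournament.exactlyOne _ _ hne with h3 | h3
    · exact Or.inl ((inputGraph_adj J _ _).1 h3.1)
    · exact Or.inr ((inputGraph_adj J _ _).1 h3.1)

theorem isYes_iff (J : ACTInstance) :
    J.IsYes ↔ (RAM.inputGraph (RAM.arrayOf J.encode)).HasArcDisjointCycles J.k := by
  refine Digraph.hasArcDisjointCycles_iff_of_map Fin.val Fin.val_injective (inputGraph_adj J) ?_ _
  intro x y h
  exact ⟨⟨x, ((isTournamentOn_inputGraph J).adj_lt x y h).1⟩, rfl⟩

end ACTInstance

namespace RAM

/-! ## Derived expressions -/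

/-- The expression is nonzero. -/
def HExpr.Holds (I : ℕ → ℕ) (S : Mem) (e : HExpr) (v : ℕ → ℕ) : Prop := e.eval I S v ≠ 0

/-- The value of the expression does not depend on the variable `x`. -/
def HExpr.Fresh (x : ℕ) (e : HExpr) : Prop :=
  ∀ I S v i, e.eval I S (Function.update v x i) = e.eval I S v

namespace HExpr

def lt (e f : HExpr) : HExpr := .sub f e
def and (e f : HExpr) : HExpr := .ite e f (.const 0)
def or (e f : HExpr) : HExpr := .add e f
def not (e : HExpr) : HExpr := .sub (.const 1) e
def eq (e f : HExpr) : HExpr := (HExpr.or (.lt e f) (.lt f e)).not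
def ind (e : HExpr) : HExpr := .ite e (.const 1) (.const 0)

/-- The number of `x < n` for which `e` is nonzero. -/
def count (x : ℕ) (e : HExpr) : HExpr := .sum x e.ind

/-- The number of pairs `x, y < n` for which `e` is nonzero. -/
def count₂ (x y : ℕ) (e : HExpr) : HExpr := .sum x (.sum y e.ind)

/-- The product of `n` and `e`. -/
def rowOf (e : HExpr) : HExpr := .sum 99 e

/-- The index of the entry with row `e` and column `f` in an `n × n` matrix. -/
def idx (e f : HExpr) : HExpr := .add e.rowOf f

variable {I : ℕ → ℕ} {S : Mem} {v : ℕ → ℕ} {e f : HExpr} {x y : ℕ}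

@[simp] theorem holds_lt : (e.lt f).Holds I S v ↔ e.eval I S v < f.eval I S v := by
  simp only [Holds, lt, eval]; omega

@[simp] theorem holds_and : (e.and f).Holds I S v ↔ e.Holds I S v ∧ f.Holds I S v := by
  simp [Holds, and, eval]

@[simp] theorem holds_or : (e.or f).Holds I S v ↔ e.Holds I S v ∨ f.Holds I S v := by
  simp only [Holds, or, eval]; omega

@[simp] theorem holds_not : e.not.Holds I S v ↔ ¬ e.Holds I S v := by
  simp only [Holds, not, eval]; omega

@[simp] theorem holds_eq : (e.eq f).Holds I S v ↔ e.eval I S v = f.eval I S v := by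
  simp only [eq, holds_not, holds_or, holds_lt]; omega

open Classical in
@[simp] theorem eval_ind : e.ind.eval I S v = if e.Holds I S v then 1 else 0 := by
  simp only [Holds, ind, eval]
  congr

open Classical in
@[simp] theorem eval_ite' {c : HExpr} : (HExpr.ite c e f).eval I S v =
    if c.Holds I S v then e.eval I S v else f.eval I S v := by
  simp only [Holds, eval]
  congr

open Classical in
@[simp] theorem eval_count : (count x e).eval I S v =
    ((Finset.range (I 0)).filter fun i => e.Holds I S (Function.update v x i)).card := by
  simp [count, eval]

@[simp] theorem holds_count : (count x e).Holds I S v ↔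
    ∃ i < I 0, e.Holds I S (Function.update v x i) := by
  classical
  rw [Holds, eval_count, ← Nat.pos_iff_ne_zero, Finset.card_pos]
  simp [Finset.Nonempty]

open Classical in
@[simp] theorem eval_count₂ : (count₂ x y e).eval I S v =
    ((Finset.range (I 0) ×ˢ Finset.range (I 0)).filter fun p =>
      e.Holds I S (Function.update (Function.update v x p.1) y p.2)).card := by
  rw [Finset.card_filter, Finset.sum_product]
  simp only [count₂, eval, eval_ind]

@[simp] theorem eval_const {c : ℕ} : (HExpr.const c).eval I S v = c := rfl
@[simp] theorem eval_var : (HExpr.var x).eval I S v = v x := rfl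
@[simp] theorem eval_inp : (HExpr.inp e).eval I S v = I (e.eval I S v) := rfl
@[simp] theorem eval_read {a : ℕ} : (HExpr.read a e).eval I S v = S a (e.eval I S v) := rfl
@[simp] theorem eval_add : (HExpr.add e f).eval I S v = e.eval I S v + f.eval I S v := rfl
@[simp] theorem eval_sub : (HExpr.sub e f).eval I S v = e.eval I S v - f.eval I S v := rfl

@[simp] theorem holds_read {a : ℕ} : (HExpr.read a e).Holds I S v ↔ S a (e.eval I S v) ≠ 0 :=
  Iff.rfl
@[simp] theorem holds_inp : (HExpr.inp e).Holds I S v ↔ I (e.eval I S v) ≠ 0 := Iff.rfl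

@[simp] theorem fresh_const {c : ℕ} : (HExpr.const c).Fresh x := fun _ _ _ _ => rfl
@[simp] theorem fresh_var (h : y ≠ x) : (HExpr.var y).Fresh x :=
  fun _ _ _ _ => Function.update_of_ne h _ _
@[simp] theorem fresh_inp (h : e.Fresh x) : (HExpr.inp e).Fresh x :=
  fun I S v i => congrArg I (h I S v i)
@[simp] theorem fresh_read {a : ℕ} (h : e.Fresh x) : (HExpr.read a e).Fresh x :=
  fun I S v i => congrArg (S a) (h I S v i)

-- Multiplication by `n` is a sum of `n` equal terms over the variable `99`, so the terms must not
-- depend on that variable.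
@[simp] theorem eval_rowOf (h : e.Fresh 99) : e.rowOf.eval I S v = I 0 * e.eval I S v := by
  simp [rowOf, eval, h I S v]

@[simp] theorem eval_idx (h : e.Fresh 99) :
    (e.idx f).eval I S v = I 0 * e.eval I S v + f.eval I S v := by
  simp [idx, h]

end HExpr

theorem idx_inj {n u v u' v' : ℕ} (hv : v < n) (hv' : v' < n) (h : n * u + v = n * u' + v') :
    u = u' ∧ v = v' := by
  have hn : 0 < n := by omega
  have h1 := congrArg (· / n) h
  have h2 := congrArg (· % n) h
  simpa [Nat.mul_add_div hn, Nat.div_eq_of_lt, Nat.mod_eq_of_lt, hv, hv'] using And.intro h1 h2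

theorem Cmd.denote_ite (I : ℕ → ℕ) (c : HExpr) (p q : Cmd) (v : ℕ → ℕ) (S : Mem)
    [Decidable (c.Holds I S v)] : (Cmd.ite c p q).denote I v S =
      if c.Holds I S v then p.denote I v S else q.denote I v S := by
  simp only [denote, HExpr.Holds]
  congr

/-- A loop that fills an array. -/
theorem Cmd.denote_table {I : ℕ → ℕ} {S : Mem} {v : ℕ → ℕ} {x a : ℕ} {e : HExpr} {f : ℕ → ℕ}
    (h : ∀ i < I 0, ∀ S' : Mem, (∀ b ≠ a, S' b = S b) →
      e.eval I S' (Function.update v x i) = f i) :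
    (∀ i < I 0, (Cmd.iter x (.write a (.var x) e)).denote I v S a i = f i) ∧
      ∀ b ≠ a, (Cmd.iter x (.write a (.var x) e)).denote I v S b = S b := by
  refine Cmd.iter_induction (fun j S' => (∀ i < j, S' a i = f i) ∧ ∀ b ≠ a, S' b = S b)
    ⟨by simp, fun _ _ => rfl⟩ ?_
  rintro i hi S' ⟨h1, h2⟩
  refine ⟨fun j hj => ?_, fun b hb => ?_⟩
  · by_cases hij : j = i
    · subst hij
      simp [denote, Mem.set, h j hi S' h2]
    · simp [denote, Mem.set, hij, h1 j (by omega)]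
  · simp [denote, Mem.set, hb, h2 b hb]

end RAM

namespace RAM.Kernel

open HExpr Digraph

/-! ## The program: packing triangles greedily

Array `1` marks the arcs of the packing, cell `0` of array `2` counts its triangles. -/

def adj (a b : HExpr) : HExpr := .inp (.add (.const 2) (idx a b))

/-- An arc that is not in the packing. -/
def arc (a b : HExpr) : HExpr := (adj a b).and (HExpr.read 1 (idx a b)).not

def packStep : Cmd :=
  .ite ((arc (.var 0) (.var 1)).and ((arc (.var 1) (.var 2)).and (arc (.var 2) (.var 0))))
    (.seq (.write 1 (idx (.var 0) (.var 1)) (.const 1))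
      (.seq (.write 1 (idx (.var 1) (.var 2)) (.const 1))
        (.seq (.write 1 (idx (.var 2) (.var 0)) (.const 1))
          (.write 2 (.const 0) (.add (.read 2 (.const 0)) (.const 1))))))
    .skip

def pack : Cmd := .iter 0 (.iter 1 (.iter 2 packStep))

variable {I : ℕ → ℕ} {S : Mem} {v : ℕ → ℕ} {a b : HExpr}

@[simp] theorem holds_adj (ha : a.Fresh 99) : (adj a b).Holds I S v ↔
    I (2 + (I 0 * a.eval I S v + b.eval I S v)) ≠ 0 := by
  simp [adj, ha]

theorem holds_adj_iff (ha : a.Fresh 99) (ha' : a.eval I S v < I 0) (hb' : b.eval I S v < I 0) :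
    (adj a b).Holds I S v ↔ (inputGraph I).Adj (a.eval I S v) (b.eval I S v) := by
  simp [ha, inputGraph, ha', hb']

/-- Array `1` marks the arcs of `X`. -/
def Marks (I : ℕ → ℕ) (S : Mem) (X : Finset (ℕ × ℕ)) : Prop :=
  ∀ u < I 0, ∀ v < I 0, S 1 (I 0 * u + v) ≠ 0 ↔ (u, v) ∈ X

/-- The arcs outside `X`. -/
def FreeArc (I : ℕ → ℕ) (X : Finset (ℕ × ℕ)) (u v : ℕ) : Prop :=
  (inputGraph I).Adj u v ∧ (u, v) ∉ X

theorem holds_arc {X : Finset (ℕ × ℕ)} (hS : Marks I S X)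
    (ha : a.Fresh 99) (ha' : a.eval I S v < I 0) (hb' : b.eval I S v < I 0) :
    (arc a b).Holds I S v ↔ FreeArc I X (a.eval I S v) (b.eval I S v) := by
  rw [arc, holds_and, holds_adj_iff ha ha' hb', holds_not, holds_read, eval_idx ha,
    hS _ ha' _ hb', FreeArc]

/-- A triangle packing is stored, and no triangle outside the packing satisfies `P`. -/
def Packed (I : ℕ → ℕ) (S : Mem) (P : ℕ → ℕ → ℕ → Prop) : Prop :=
  ∃ X t, TrianglePacking (inputGraph I) X t ∧ S 2 0 = t ∧ Marks I S X ∧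
    (∀ a b c, P a b c → FreeArc I X a b → FreeArc I X b c → ¬ FreeArc I X c a) ∧
    ∀ a, a ≠ 1 → a ≠ 2 → S a = fun _ => 0

theorem Packed.mono {P P' : ℕ → ℕ → ℕ → Prop} (h : Packed I S P)
    (hP : ∀ a < I 0, ∀ b < I 0, ∀ c < I 0, P' a b c → P a b c) : Packed I S P' := by
  obtain ⟨X, t, h1, h2, h3, h4, h5⟩ := h
  exact ⟨X, t, h1, h2, h3, fun a b c hp hab hbc hca =>
    h4 a b c (hP a hab.1.1 b hbc.1.1 c hca.1.1 hp) hab hbc hca, h5⟩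

/-- Packing only removes free arcs, so a triple once tested never becomes a free triangle later.
This is why a single pass gives a maximal packing. -/
theorem packed_packStep {P : ℕ → ℕ → ℕ → Prop} (h : Packed I S P) {i j k : ℕ} (hi : i < I 0)
    (hj : j < I 0) (hk : k < I 0) (hvi : v 0 = i) (hvj : v 1 = j) (hvk : v 2 = k) :
    Packed I (packStep.denote I v S) (fun a b c => P a b c ∨ (a = i ∧ b = j ∧ c = k)) := by
  classical
  obtain ⟨X, t, h1, h2, h3, h4, h5⟩ := h
  rw [packStep, Cmd.denote_ite]
  have hc : ((arc (.var 0) (.var 1)).and ((arc (.var 1) (.var 2)).and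
      (arc (.var 2) (.var 0)))).Holds I S v ↔
      FreeArc I X i j ∧ FreeArc I X j k ∧ FreeArc I X k i := by
    rw [holds_and, holds_and, holds_arc h3, holds_arc h3, holds_arc h3] <;>
      simp [hvi, hvj, hvk, hi, hj, hk]
  rw [if_congr hc rfl rfl]
  split_ifs with hT
  · refine ⟨X ∪ {(i, j), (j, k), (k, i)}, t + 1, h1.insert hT.1.1 hT.2.1.1 hT.2.2.1 hT.1.2 hT.2.1.2
      hT.2.2.2, ?_, ?_, ?_, ?_⟩
    · simp [Cmd.denote, Mem.set, h2]
    · intro u hu w hw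
      have hidx : ∀ a < I 0, ∀ b < I 0, (I 0 * u + w = I 0 * a + b ↔ u = a ∧ w = b) :=
        fun a ha b hb => ⟨idx_inj hw hb, fun h => by rw [h.1, h.2]⟩
      have h01 : (0 : ℕ) ≠ 99 := by norm_num
      have h02 : (1 : ℕ) ≠ 99 := by norm_num
      have h03 : (2 : ℕ) ≠ 99 := by norm_num
      have h12 : (1 : ℕ) ≠ 2 := by norm_num
      simp only [Cmd.denote, Mem.set, Function.update_self, Function.update_of_ne h12,
        eval_idx (fresh_var h01), eval_idx (fresh_var h02), eval_idx (fresh_var h03), eval_var,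
        eval_const, hvi, hvj, hvk, Function.update_apply, hidx i hi j hj, hidx j hj k hk,
        hidx k hk i hi, Finset.mem_union, Finset.mem_insert, Finset.mem_singleton, Prod.mk.injEq,
        ← h3 u hu w hw]
      split_ifs <;> simp_all
    · intro a b c hP hab hbc hca
      have hm : ∀ x y, FreeArc I (X ∪ {(i, j), (j, k), (k, i)}) x y → FreeArc I X x y ∧
          (x, y) ≠ (i, j) := by
        intro x y hxy
        have h := hxy.2
        simp only [Finset.mem_union, Finset.mem_insert, not_or] at h
        exact ⟨⟨hxy.1, h.1⟩, h.2.1⟩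
      rcases hP with hP | ⟨rfl, rfl, rfl⟩
      · exact h4 a b c hP (hm _ _ hab).1 (hm _ _ hbc).1 (hm _ _ hca).1
      · exact (hm _ _ hab).2 rfl
    · intro a ha ha'
      simp [Cmd.denote, Mem.set, ha, ha', h5 a ha ha']
  · refine ⟨X, t, h1, h2, h3, ?_, h5⟩
    rintro a b c (hP | ⟨rfl, rfl, rfl⟩) hab hbc hca
    · exact h4 a b c hP hab hbc hca
    · exact hT ⟨hab, hbc, hca⟩

/-- The invariants of the three nested loops describe the triples that lexicographically precede the
current one. -/
theorem packed_pack : Packed I (pack.denote I v fun _ _ => 0) (fun _ _ _ => True) := by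
  have h0 : Packed I (fun _ _ => 0) (fun a _ _ => a < 0) :=
    ⟨∅, 0, .empty, rfl, fun _ _ _ _ => by simp, fun _ _ _ h => absurd h (by omega),
      fun _ _ _ => rfl⟩
  have h1 := Cmd.iter_induction (I := I) (x := 0) (p := .iter 1 (.iter 2 packStep)) (v := v)
    (fun i S => Packed I S (fun a _ _ => a < i)) h0 ?_
  · exact h1.mono fun a ha _ _ _ _ _ => ha
  intro i hi S hS
  have h2 := Cmd.iter_induction (I := I) (x := 1) (p := .iter 2 packStep)
    (v := Function.update v 0 i)
    (fun j S => Packed I S (fun a b _ => a < i ∨ a = i ∧ b < j)) (hS.mono ?_) ?_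
  · exact h2.mono fun a _ b hb _ _ h => by omega
  · intro a _ b _ c _ h
    omega
  intro j hj S hS
  have h3 := Cmd.iter_induction (I := I) (x := 2) (p := packStep)
    (v := Function.update (Function.update v 0 i) 1 j)
    (fun k S => Packed I S (fun a b c => (a < i ∨ a = i ∧ b < j) ∨ a = i ∧ b = j ∧ c < k))
    (hS.mono ?_) ?_
  · exact h3.mono fun a _ b _ c hc h => by omega
  · intro a _ b _ c _ h
    omega
  intro k hk S hS
  refine (packed_packStep hS hi hj hk ?_ ?_ ?_).mono ?_
  · simp
  · simp
  · simp
  · intro a _ b _ c _ h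
    omega

/-! ## The program: ordering the vertices

Array `3` holds labels, array `4` marks the vertices that have been pivots. -/

def lab (a : HExpr) : HExpr := .read 3 a

def inducedPath (a b c : HExpr) : HExpr :=
  ((lab a).eq (lab b)).and (((lab b).eq (lab c)).and ((arc a b).and ((arc b c).and
    ((a.eq c).not.and ((arc a c).not.and (arc c a).not)))))

def isPivot : HExpr :=
  (HExpr.read 4 (.var 1)).not.and
    ((count₂ 2 3 (inducedPath (.var 2) (.var 1) (.var 3))).lt
      (count₂ 2 3 (inducedPath (.var 1) (.var 2) (.var 3)))).not

def newLabel : HExpr :=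
  .add (.add (lab (.var 2)) (.add (lab (.var 2)) (lab (.var 2))))
    (.ite ((lab (.var 2)).eq (lab (.var 1)))
      (.ite ((HExpr.var 2).eq (.var 1)) (.const 1)
        (.ite (arc (.var 1) (.var 2)) (.const 2) (.const 0))) (.const 0))

/-- The detour through array `5` is needed because each new label depends on the old label of the
pivot. -/
def split : Cmd :=
  .seq (.iter 2 (.write 5 (.var 2) newLabel))
    (.seq (.iter 2 (.write 3 (.var 2) (.read 5 (.var 2)))) (.write 4 (.var 1) (.const 1)))

def order : Cmd := .iter 0 (.iter 1 (.ite isPivot split .skip))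

/-- The state of the ordering procedure. -/
structure Ordering (I : ℕ → ℕ) (X : Finset (ℕ × ℕ)) (S₀ S : Mem) : Prop where
  frame : ∀ a, a ≠ 3 → a ≠ 4 → a ≠ 5 → S a = S₀ a
  le : (backwardPairs (Finset.range (I 0)) (FreeArc I X) (S 3)).card ≤
    (missingPairs (Finset.range (I 0)) (FreeArc I X) (S 3)).card
  unique : ∀ v ∈ Finset.range (I 0), S 4 v ≠ 0 → ∀ u ∈ Finset.range (I 0), S 3 u = S 3 v → u = v

/-- The vertices that have been pivots. -/
def doneSet (I : ℕ → ℕ) (S : Mem) : Finset ℕ := (Finset.range (I 0)).filter fun v => S 4 v ≠ 0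

theorem Ordering.marks {X : Finset (ℕ × ℕ)} {S₀ : Mem} (h : Ordering I X S₀ S)
    (hX : Marks I S₀ X) : Marks I S X := by
  intro u hu v hv
  rw [h.frame 1 (by norm_num) (by norm_num) (by norm_num)]
  exact hX u hu v hv

theorem holds_inducedPath {X : Finset (ℕ × ℕ)} (hX : Marks I S X) {i j k : ℕ} (hi : i ≠ 99)
    (hj : j ≠ 99) (hk : k ≠ 99) (hi' : v i < I 0) (hj' : v j < I 0) (hk' : v k < I 0) :
    (inducedPath (.var i) (.var j) (.var k)).Holds I S v ↔
      InducedPath (FreeArc I X) (S 3) (v i) (v j) (v k) := by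
  simp only [inducedPath, holds_and, holds_not, holds_eq, lab, eval_read, eval_var,
    InducedPath, ne_eq]
  rw [holds_arc hX, holds_arc hX, holds_arc hX, holds_arc hX] <;> simp [*]

theorem holds_isPivot {X : Finset (ℕ × ℕ)} (hX : Marks I S X) (hv : v 1 < I 0) :
    isPivot.Holds I S v ↔ S 4 (v 1) = 0 ∧
      (pathsFrom (Finset.range (I 0)) (FreeArc I X) (S 3) (v 1)).card ≤
        (pathsThrough (Finset.range (I 0)) (FreeArc I X) (S 3) (v 1)).card := by
  classical
  have h1 : (count₂ 2 3 (inducedPath (.var 1) (.var 2) (.var 3))).eval I S v =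
      (pathsFrom (Finset.range (I 0)) (FreeArc I X) (S 3) (v 1)).card := by
    rw [eval_count₂, pathsFrom]
    congr 1
    refine Finset.filter_congr fun p hp => ?_
    rw [Finset.mem_product, Finset.mem_range, Finset.mem_range] at hp
    rw [holds_inducedPath hX] <;> simp [hv, hp]
  have h2 : (count₂ 2 3 (inducedPath (.var 2) (.var 1) (.var 3))).eval I S v =
      (pathsThrough (Finset.range (I 0)) (FreeArc I X) (S 3) (v 1)).card := by
    rw [eval_count₂, pathsThrough]
    congr 1
    refine Finset.filter_congr fun p hp => ?_
    rw [Finset.mem_product, Finset.mem_range, Finset.mem_range] at hp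
    rw [holds_inducedPath hX] <;> simp [hv, hp]
  rw [isPivot, holds_and, holds_not, holds_not, holds_lt, h1, h2, holds_read, eval_var]
  simp

theorem denote_split {X : Finset (ℕ × ℕ)} (hX : Marks I S X) (hv : v 1 < I 0) :
    (∀ u < I 0, split.denote I v S 3 u = splitLabel (FreeArc I X) (S 3) (v 1) u) ∧
      split.denote I v S 4 = Function.update (S 4) (v 1) 1 ∧
      ∀ a, a ≠ 3 → a ≠ 4 → a ≠ 5 → split.denote I v S a = S a := by
  classical
  obtain ⟨h1, h2⟩ := Cmd.denote_table (I := I) (S := S) (v := v) (x := 2) (a := 5) (e := newLabel)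
    (f := splitLabel (FreeArc I X) (S 3) (v 1)) (by
      intro i hi S' hS'
      have hX' : Marks I S' X := by
        intro u hu v hv
        rw [hS' 1 (by norm_num)]
        exact hX u hu v hv
      have harc : (arc (.var 1) (.var 2)).Holds I S' (Function.update v 2 i) ↔
          FreeArc I X (v 1) i := by
        rw [holds_arc hX'] <;> simp [hv, hi]
      simp only [newLabel, eval_add, lab, eval_read, eval_var, Function.update_self, eval_ite',
        holds_eq, eval_const, hS' 3 (by norm_num),
        Function.update_of_ne (show (1 : ℕ) ≠ 2 by norm_num), harc, splitLabel]
      split_ifs <;> omega)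
  obtain ⟨h3, h4⟩ := Cmd.denote_table (I := I)
    (S := (Cmd.iter 2 (.write 5 (.var 2) newLabel)).denote I v S) (v := v) (x := 2) (a := 3)
    (e := .read 5 (.var 2)) (f := splitLabel (FreeArc I X) (S 3) (v 1)) (by
      intro i hi S' hS'
      rw [eval_read, hS' 5 (by norm_num), eval_var, Function.update_self, h1 i hi])
  refine ⟨fun u hu => ?_, ?_, fun a ha ha' ha'' => ?_⟩
  · rw [← h3 u hu]
    simp [split, Cmd.denote, Mem.set]
  · have : ∀ S' : Mem, (Cmd.write 4 (.var 1) (.const 1)).denote I v S' 4 =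
        Function.update (S' 4) (v 1) 1 := by
      intro S'
      simp [Cmd.denote, Mem.set]
    rw [← h2 4 (by norm_num), ← h4 4 (by norm_num), ← this]
    rfl
  · rw [← h2 a ha'', ← h4 a ha]
    simp only [split, Cmd.denote, Mem.set, Function.update_of_ne ha']

theorem Ordering.split {X : Finset (ℕ × ℕ)} {S₀ : Mem} (hG : (inputGraph I).IsTournamentOn (I 0))
    (hX : Marks I S₀ X)
    (htri : ∀ a b c, FreeArc I X a b → FreeArc I X b c → ¬ FreeArc I X c a)
    (h : Ordering I X S₀ S) (hv : v 1 < I 0) (hp : isPivot.Holds I S v) :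
    Ordering I X S₀ (split.denote I v S) ∧ v 1 ∉ doneSet I S ∧
      doneSet I (split.denote I v S) = insert (v 1) (doneSet I S) := by
  have hX' := h.marks hX
  rw [holds_isPivot hX' hv] at hp
  obtain ⟨h1, h2, h3⟩ := denote_split hX' hv
  have hc := card_backwardPairs_splitLabel_le (fun a ha => hG.irrefl a ha.1)
    (fun a b hab hba => hG.asymm a b hab.1 hba.1) htri hp.2 h.le
  refine ⟨⟨fun a ha ha' ha'' => (h3 a ha ha' ha'').trans (h.frame a ha ha' ha''), ?_, ?_⟩, ?_, ?_⟩
  · convert hc using 2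
    · ext ⟨a, b⟩
      simp only [mem_backwardPairs, Finset.mem_range]
      refine and_congr_right fun hab => ?_
      rw [h1 a hab.1, h1 b hab.2]
    · ext ⟨a, b⟩
      simp only [mem_missingPairs, Finset.mem_range]
      refine and_congr_right fun hab => ?_
      rw [h1 a hab.1, h1 b hab.2]
  · intro w hw hdone u hu hlab
    rw [h1 u (Finset.mem_range.1 hu), h1 w (Finset.mem_range.1 hw)] at hlab
    by_cases hwv : w = v 1
    · rw [hwv] at hlab ⊢
      exact eq_of_splitLabel_eq hlab
    · rw [h2, Function.update_of_ne hwv] at hdone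
      exact h.unique w hw hdone u hu (lab_eq_of_splitLabel_eq hlab)
  · simp [doneSet, hp.1]
  · ext w
    simp only [doneSet, h2, Finset.mem_insert, Finset.mem_filter, Finset.mem_range]
    by_cases hwv : w = v 1
    · simp [hwv, hv]
    · simp [hwv]

/-- While some vertex has not been a pivot, `exists_pivot` guarantees that a round of the outer loop
marks a new one. After `n` rounds all vertices have been pivots, each is alone in its class, and the
labels are injective. -/
theorem ordering_order {X : Finset (ℕ × ℕ)} {S₀ : Mem}
    (hG : (inputGraph I).IsTournamentOn (I 0)) (hX : Marks I S₀ X)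
    (htri : ∀ a b c, FreeArc I X a b → FreeArc I X b c → ¬ FreeArc I X c a)
    (h3 : S₀ 3 = fun _ => 0) (h4 : S₀ 4 = fun _ => 0) :
    Ordering I X S₀ (order.denote I v S₀) ∧
      Set.InjOn (order.denote I v S₀ 3) (Finset.range (I 0)) := by
  classical
  have key := Cmd.iter_induction (I := I) (x := 0) (p := .iter 1 (.ite isPivot split .skip))
    (v := v) (S := S₀) (fun r S => Ordering I X S₀ S ∧ r ≤ (doneSet I S).card)
    ⟨⟨fun _ _ _ _ => rfl, ?_, ?_⟩, Nat.zero_le _⟩ ?_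
  · refine ⟨key.1, ?_⟩
    have hall : doneSet I (order.denote I v S₀) = Finset.range (I 0) :=
      Finset.eq_of_subset_of_card_le (Finset.filter_subset _ _) (by rw [Finset.card_range]; exact key.2)
    intro a ha b hb hab
    have hb' := hb
    rw [Finset.mem_coe, ← hall] at hb'
    exact key.1.unique b hb (Finset.mem_filter.1 hb').2 a ha hab
  · rw [show backwardPairs (Finset.range (I 0)) (FreeArc I X) (S₀ 3) = ∅ from ?_]
    · simp
    · ext ⟨a, b⟩
      simp [mem_backwardPairs, h3]
  · intro v _ hv
    simp [h4] at hv
  intro r hr S ⟨hS, hrS⟩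
  -- Either this round has already marked a new vertex, or the state is still `S` and all vertices
  -- before `j` were rejected in it.
  have inner := Cmd.iter_induction (I := I) (x := 1) (p := .ite isPivot split .skip)
    (v := Function.update v 0 r) (S := S)
    (fun j S' => Ordering I X S₀ S' ∧ (r + 1 ≤ (doneSet I S').card ∨ S' = S ∧ ∀ w < j,
      ¬ isPivot.Holds I S (Function.update (Function.update v 0 r) 1 w)))
    ⟨hS, Or.inr ⟨rfl, fun _ h => absurd h (by omega)⟩⟩ ?_
  · refine ⟨inner.1, ?_⟩
    rcases inner.2 with h | ⟨heq, hno⟩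
    · exact h
    · rw [heq]
      by_contra hcard
      have hex : ∃ w ∈ Finset.range (I 0), ¬ S 4 w ≠ 0 := by
        by_contra! hall
        rw [doneSet, Finset.filter_true_of_mem hall, Finset.card_range] at hcard
        omega
      obtain ⟨w, hw, hw4, hle⟩ := exists_pivot (D := FreeArc I X) (fun a ha => hG.irrefl a ha.1) (fun w => S 4 w ≠ 0)
        hS.unique hex
      have hw := Finset.mem_range.1 hw
      refine hno w hw ((holds_isPivot (hS.marks hX) (by simpa using hw)).2 ?_)
      simpa using ⟨not_not.1 hw4, hle⟩
  · intro j hj S' ⟨hS', hor⟩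
    rw [Cmd.denote_ite]
    split_ifs with hp
    · obtain ⟨g1, g2, g3⟩ := hS'.split hG hX htri (by simpa using hj) hp
      refine ⟨g1, Or.inl ?_⟩
      rw [g3, Finset.card_insert_of_notMem g2]
      rcases hor with h | ⟨rfl, -⟩
      · omega
      · omega
    · refine ⟨hS', hor.imp_right fun ⟨h, hno⟩ => ⟨h, fun w hw => ?_⟩⟩
      rcases Nat.lt_succ_iff_lt_or_eq.1 hw with hw | rfl
      · exact hno w hw
      · rwa [← h]

end RAM.Kernel

namespace RAM.Kernel

open HExpr Digraph

variable {I : ℕ → ℕ} {S : Mem} {v : ℕ → ℕ} {a b : HExpr}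

/-! ## The program: sorting the vertices

Array `6` lists the vertices in the order of their labels. -/

def sort : Cmd :=
  .iter 0 (.write 6 (count 1 ((lab (.var 1)).lt (lab (.var 0)))) (.var 0))

/-- `ord` lists the numbers below `n` in the order of their labels. -/
structure Sorted (n : ℕ) (l ord : ℕ → ℕ) : Prop where
  lt : ∀ i < n, ord i < n
  mono : ∀ i < n, ∀ j < n, i < j → l (ord i) < l (ord j)
  surj : ∀ u < n, ∃ i < n, ord i = u

/-- An injective rank into `range n` is onto, so `ord` is its inverse. -/
theorem sorted_of_rank {n : ℕ} {l ord r : ℕ → ℕ} (hr : ∀ u < n, r u < n)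
    (hmono : ∀ u < n, ∀ w < n, l u < l w → r u < r w) (hl : Set.InjOn l (Finset.range n))
    (hord : ∀ u < n, ord (r u) = u) : Sorted n l ord := by
  have hmaps : Set.MapsTo r (Finset.range n) (Finset.range n) := fun u hu => by
    simpa using hr u (by simpa using hu)
  have hinj : Set.InjOn r (Finset.range n) := by
    intro u hu w hw h
    have hu' : u < n := by simpa using hu
    have hw' : w < n := by simpa using hw
    rw [← hord u hu', ← hord w hw', h]
  have hsurj : ∀ i < n, ∃ u < n, r u = i := by
    intro i hi
    obtain ⟨u, hu, h⟩ := Finset.surjOn_of_injOn_of_card_le r hmaps hinj le_rfl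
      (show i ∈ (Finset.range n : Set ℕ) by simpa using hi)
    exact ⟨u, by simpa using hu, h⟩
  refine ⟨fun i hi => ?_, fun i hi j hj hij => ?_, fun u hu => ⟨r u, hr u hu, hord u hu⟩⟩
  · obtain ⟨u, hu, rfl⟩ := hsurj i hi
    rwa [hord u hu]
  · obtain ⟨u, hu, rfl⟩ := hsurj i hi
    obtain ⟨w, hw, rfl⟩ := hsurj j hj
    rw [hord u hu, hord w hw]
    by_contra hlt
    rcases (not_lt.1 hlt).lt_or_eq with h | h
    · have := hmono w hw u hu h
      omega
    · have := hl (by simpa using hw) (by simpa using hu) h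
      subst this
      omega

theorem sorted_sort (hl : Set.InjOn (S 3) (Finset.range (I 0))) :
    Sorted (I 0) (S 3) (sort.denote I v S 6) ∧ ∀ a ≠ 6, sort.denote I v S a = S a := by
  classical
  let r : ℕ → ℕ := fun u => ((Finset.range (I 0)).filter fun w => S 3 w < S 3 u).card
  have hmono : ∀ u < I 0, ∀ w < I 0, S 3 u < S 3 w → r u < r w := by
    intro u hu w hw h
    refine Finset.card_lt_card ⟨fun x hx => ?_, fun hsub => ?_⟩
    · rw [Finset.mem_filter] at hx ⊢
      exact ⟨hx.1, hx.2.trans h⟩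
    · have := hsub (Finset.mem_filter.2 ⟨Finset.mem_range.2 hu, h⟩)
      exact lt_irrefl _ (Finset.mem_filter.1 this).2
  have hr : ∀ u < I 0, r u < I 0 := by
    intro u hu
    calc r u < (Finset.range (I 0)).card := Finset.card_lt_card ⟨Finset.filter_subset _ _,
          fun hsub => lt_irrefl _ (Finset.mem_filter.1 (hsub (Finset.mem_range.2 hu))).2⟩
      _ = I 0 := Finset.card_range _
  have hinj : ∀ u < I 0, ∀ w < I 0, r u = r w → u = w := by
    intro u hu w hw h
    rcases lt_trichotomy (S 3 u) (S 3 w) with h1 | h1 | h1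
    · exact absurd h (hmono u hu w hw h1).ne
    · exact hl (by simpa using hu) (by simpa using hw) h1
    · exact absurd h (hmono w hw u hu h1).ne'
  have key := Cmd.iter_induction (I := I) (x := 0) (S := S) (v := v)
    (p := .write 6 (count 1 ((lab (.var 1)).lt (lab (.var 0)))) (.var 0))
    (fun i S' => (∀ u < i, S' 6 (r u) = u) ∧ ∀ a ≠ 6, S' a = S a)
    ⟨fun _ h => absurd h (by omega), fun _ _ => rfl⟩ ?_
  · exact ⟨sorted_of_rank hr hmono hl key.1, key.2⟩
  · rintro i hi S' ⟨h1, h2⟩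
    have hval : (count 1 ((lab (.var 1)).lt (lab (.var 0)))).eval I S' (Function.update v 0 i) =
        r i := by
      rw [eval_count]
      simp [lab, h2 3, r]
    simp only [Cmd.denote, hval, Mem.set, eval_var, Function.update_self]
    refine ⟨fun u hu => ?_, fun a ha => by rw [Function.update_of_ne ha, h2 a ha]⟩
    rcases Nat.lt_succ_iff_lt_or_eq.1 hu with hu' | rfl
    · rw [Function.update_of_ne (fun h => hu'.ne (hinj u (by omega) i hi h)), h1 u hu']
    · rw [Function.update_self]

/-- The input digraph with the vertices numbered in the order `ord`. -/
def posGraph (I ord : ℕ → ℕ) : Digraph ℕ where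
  Adj i j := (i < I 0 ∧ j < I 0) ∧ (inputGraph I).Adj (ord i) (ord j)

section

variable {l ord : ℕ → ℕ}

theorem Sorted.inj (h : Sorted (I 0) l ord) {i j : ℕ} (hi : i < I 0) (hj : j < I 0)
    (hij : ord i = ord j) : i = j := by
  rcases lt_trichotomy i j with h1 | h1 | h1
  · have := h.mono i hi j hj h1
    rw [hij] at this
    omega
  · exact h1
  · have := h.mono j hj i hi h1
    rw [hij] at this
    omega

theorem Sorted.isTournamentOn (h : Sorted (I 0) l ord)
    (hG : (inputGraph I).IsTournamentOn (I 0)) : (posGraph I ord).IsTournamentOn (I 0) := by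
  refine ⟨fun _ _ h => h.1, fun u h => hG.irrefl _ h.2, fun u w h h' => hG.asymm _ _ h.2 h'.2,
    fun u hu w hw hne => ?_⟩
  exact (hG.total _ (h.lt u hu) _ (h.lt w hw) fun heq => hne (h.inj hu hw heq)).imp
    (fun h => ⟨⟨hu, hw⟩, h⟩) (fun h => ⟨⟨hw, hu⟩, h⟩)

theorem Sorted.hasArcDisjointCycles_iff (h : Sorted (I 0) l ord) (k : ℕ) :
    (inputGraph I).HasArcDisjointCycles k ↔ (posGraph I ord).HasArcDisjointCycles k := by
  let K : Digraph (Fin (I 0)) := ⟨fun i j => (inputGraph I).Adj (ord i) (ord j)⟩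
  have h1 := hasArcDisjointCycles_iff_of_map (G := K) (H := inputGraph I) (fun i => ord i)
    (fun i j hij => Fin.ext (h.inj i.2 j.2 hij)) (fun _ _ => Iff.rfl) (fun x y hxy => by
      obtain ⟨i, hi, rfl⟩ := h.surj x hxy.1
      exact ⟨⟨i, hi⟩, rfl⟩) k
  have h2 := hasArcDisjointCycles_iff_of_map (G := K) (H := posGraph I ord) Fin.val
    Fin.val_injective (fun u w => by simp [K, posGraph])
    (fun x y hxy => ⟨⟨x, hxy.1.1⟩, rfl⟩) k
  exact h1.symm.trans h2

theorem Sorted.card_backArcs_le (h : Sorted (I 0) l ord) :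
    ((posGraph I ord).backArcs (I 0)).card ≤
      (backwardPairs (Finset.range (I 0)) (inputGraph I).Adj l).card := by
  classical
  refine Finset.card_le_card_of_injOn (Prod.map ord ord) ?_ ?_
  · rintro ⟨i, j⟩ hij
    simp only [backArcs, Finset.coe_filter, Set.mem_ofPred_eq, Finset.mem_product,
      Finset.mem_range] at hij
    obtain ⟨⟨hi, hj⟩, hlt, hadj⟩ := hij
    rw [Finset.mem_coe, Prod.map_apply, mem_backwardPairs, Finset.mem_range, Finset.mem_range]
    exact ⟨⟨h.lt i hi, h.lt j hj⟩, h.mono i hi j hj hlt, hadj.2⟩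
  · rintro ⟨i, j⟩ hij ⟨i', j'⟩ hij' heq
    simp only [backArcs, Finset.coe_filter, Set.mem_ofPred_eq, Finset.mem_product,
      Finset.mem_range] at hij hij'
    simp only [Prod.map_apply, Prod.mk.injEq] at heq
    rw [h.inj hij.1.1 hij'.1.1 heq.1, h.inj hij.1.2 hij'.1.2 heq.2]

end

/-! ## The program: the optimal set of unaffected vertices

Cell `j` of array `7` holds the maximal value of a set below `j`, row `j` of array `8` such a
set. -/

def posAdj (a b : HExpr) : HExpr := adj (.read 6 a) (.read 6 b)

def back (a b : HExpr) : HExpr := (a.lt b).and (posAdj b a)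

def free (a : HExpr) : HExpr :=
  (count 13 ((back (.var 13) a).or (back a (.var 13)))).not

def between (a b : HExpr) : HExpr :=
  count₂ 10 11 ((back (.var 10) (.var 11)).and ((a.lt (.var 10)).and ((HExpr.var 11).lt b)))

def below (b : HExpr) : HExpr :=
  count₂ 10 11 ((back (.var 10) (.var 11)).and ((HExpr.var 11).lt b))

def candidate (j : HExpr) : HExpr :=
  .add (.add (.read 7 (.var 1)) (.const 1)) (between (.var 1) j)

def copyRow (j : HExpr) : Cmd :=
  .iter 2 (.write 8 (idx j (.var 2)) (HExpr.or ((HExpr.var 2).eq (.var 1))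
    (.read 8 (idx (.var 1) (.var 2)))).ind)

def improve (j : HExpr) : Cmd :=
  .ite (((HExpr.var 1).lt j).and ((free (.var 1)).and ((HExpr.read 7 j).lt (candidate j))))
    (.seq (.write 7 j (candidate j)) (copyRow j)) .skip

def bestStep (j : HExpr) : Cmd := .seq (.write 7 j (below j)) (.iter 1 (improve j))

/-- The loop treats only `j < n`; the additional step for `j = n` gives the optimum over all
unaffected vertices. -/
def best : Cmd := .seq (.iter 0 (bestStep (.var 0))) (bestStep (.inp (.const 0)))

/-- Array `6` lists the vertices. -/
def Listed (I : ℕ → ℕ) (S : Mem) : Prop := ∀ i < I 0, S 6 i < I 0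

theorem holds_posAdj (hS : Listed I S) (ha : a.Fresh 99) (ha' : a.eval I S v < I 0)
    (hb' : b.eval I S v < I 0) :
    (posAdj a b).Holds I S v ↔ (posGraph I (S 6)).Adj (a.eval I S v) (b.eval I S v) := by
  rw [posAdj, holds_adj_iff (b := .read 6 b) (fresh_read ha) (hS _ ha') (hS _ hb')]
  simp [posGraph, ha', hb']

theorem holds_back (hS : Listed I S) (hb : b.Fresh 99) (ha' : a.eval I S v < I 0)
    (hb' : b.eval I S v < I 0) :
    (back a b).Holds I S v ↔
      (a.eval I S v, b.eval I S v) ∈ (posGraph I (S 6)).backArcs (I 0) := by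
  classical
  rw [back, holds_and, holds_lt, holds_posAdj hS hb hb' ha']
  simp [backArcs, ha', hb']

theorem mem_backArcs_lt {G : Digraph ℕ} {n i j : ℕ} (h : (i, j) ∈ G.backArcs n) :
    i < n ∧ j < n := by
  classical
  simpa using (Finset.mem_filter.1 h).1

theorem holds_free (hS : Listed I S) {i : ℕ} (hi : i ≠ 99) (hi' : i ≠ 13) (hv : v i < I 0) :
    (free (.var i)).Holds I S v ↔ v i ∈ (posGraph I (S 6)).unaffected (I 0) := by
  classical
  have h1 : ∀ w < I 0, ((back (.var 13) (.var i)).or (back (.var i) (.var 13))).Holds I S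
      (Function.update v 13 w) ↔ (w, v i) ∈ (posGraph I (S 6)).backArcs (I 0) ∨
        (v i, w) ∈ (posGraph I (S 6)).backArcs (I 0) := by
    intro w hw
    rw [holds_or, holds_back hS, holds_back hS] <;> simp [*]
  rw [free, holds_not, holds_count, unaffected, Finset.mem_filter, Finset.mem_range]
  constructor
  · intro h
    refine ⟨hv, ?_⟩
    rintro ⟨x, y⟩ he
    have hlt := mem_backArcs_lt he
    constructor
    · rintro rfl
      exact h ⟨y, hlt.2, (h1 y hlt.2).2 (Or.inr he)⟩
    · rintro rfl
      exact h ⟨x, hlt.1, (h1 x hlt.1).2 (Or.inl he)⟩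
  · rintro ⟨-, h⟩ ⟨w, hw, hb⟩
    rcases (h1 w hw).1 hb with h2 | h2
    · exact (h _ h2).2 rfl
    · exact (h _ h2).1 rfl

theorem eval_count₂_back (hS : Listed I S) (e : HExpr) (P : ℕ → ℕ → Prop) [DecidableRel P]
    (he : ∀ x y, e.Holds I S (Function.update (Function.update v 10 x) 11 y) ↔ P x y) :
    (count₂ 10 11 ((back (.var 10) (.var 11)).and e)).eval I S v =
      (((posGraph I (S 6)).backArcs (I 0)).filter fun p => P p.1 p.2).card := by
  classical
  rw [eval_count₂]
  congr 1
  ext ⟨x, y⟩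
  simp only [Finset.mem_filter, Finset.mem_product, Finset.mem_range, holds_and, he]
  constructor
  · rintro ⟨⟨hx, hy⟩, hb, hP⟩
    rw [holds_back hS] at hb
    · simpa using ⟨hb, hP⟩
    · simp
    · simpa using hx
    · simpa using hy
  · rintro ⟨hb, hP⟩
    have hlt := mem_backArcs_lt hb
    refine ⟨hlt, ?_, hP⟩
    rw [holds_back hS]
    · simpa using hb
    · simp
    · simpa using hlt.1
    · simpa using hlt.2

/-- The value of `j` depends on the variable `0` only. -/
def IsBound (I : ℕ → ℕ) (j : HExpr) (v : ℕ → ℕ) (J : ℕ) : Prop :=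
  ∀ S v', v' 0 = v 0 → j.eval I S v' = J

theorem eval_below (hS : Listed I S) {j : HExpr} {J : ℕ} (hj : IsBound I j v J) :
    (below j).eval I S v = (posGraph I (S 6)).prefixValue (I 0) J ∅ := by
  classical
  rw [below, eval_count₂_back hS _ (fun _ y => y < J), prefixValue_empty]
  intro x y
  rw [holds_lt, hj S _ (by simp)]
  simp

theorem eval_between (hS : Listed I S) {j : HExpr} {J : ℕ} (hj : IsBound I j v J) :
    (between (.var 1) j).eval I S v = ((posGraph I (S 6)).arcsBetween (I 0) (v 1) J).card := by
  classical
  rw [between, eval_count₂_back hS _ (fun x y => v 1 < x ∧ y < J), arcsBetween]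
  intro x y
  rw [holds_and, holds_lt, holds_lt, hj S _ (by simp)]
  simp

open Classical in
/-- The set stored in row `j` of array `8`. -/
noncomputable def rowSet (I : ℕ → ℕ) (S : Mem) (j : ℕ) : Finset ℕ :=
  (Finset.range (I 0)).filter fun x => S 8 (I 0 * j + x) ≠ 0

/-- Since `i < J`, the row that is read differs from the row that is overwritten. -/
theorem denote_copyRow {j : HExpr} {J i : ℕ} (hj : IsBound I j v J) (hf : j.Fresh 99)
    (hi : v 1 = i) (hiJ : i < J) (hin : i < I 0) :
    rowSet I ((copyRow j).denote I v S) J = insert i (rowSet I S i) ∧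
      (∀ j' ≠ J, rowSet I ((copyRow j).denote I v S) j' = rowSet I S j') ∧
      ∀ a ≠ 8, (copyRow j).denote I v S a = S a := by
  classical
  have key := Cmd.iter_induction (I := I) (x := 2) (S := S) (v := v)
    (p := .write 8 (idx j (.var 2)) (HExpr.or ((HExpr.var 2).eq (.var 1))
      (.read 8 (idx (.var 1) (.var 2)))).ind)
    (fun y S' => (∀ x < y, S' 8 (I 0 * J + x) ≠ 0 ↔ x = i ∨ S 8 (I 0 * i + x) ≠ 0) ∧
      (∀ j' ≠ J, ∀ x < I 0, S' 8 (I 0 * j' + x) = S 8 (I 0 * j' + x)) ∧ ∀ a ≠ 8, S' a = S a)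
    ⟨fun _ h => absurd h (by omega), fun _ _ _ _ => rfl, fun _ _ => rfl⟩ ?_
  · refine ⟨?_, fun j' hj' => ?_, key.2.2⟩
    · ext x
      simp only [rowSet, Finset.mem_filter, Finset.mem_range, Finset.mem_insert]
      constructor
      · rintro ⟨hx, h⟩
        exact ((key.1 x hx).1 h).imp_right fun h => ⟨hx, h⟩
      · rintro (rfl | ⟨hx, h⟩)
        · exact ⟨hin, (key.1 x hin).2 (Or.inl rfl)⟩
        · exact ⟨hx, (key.1 x hx).2 (Or.inr h)⟩
    · refine Finset.filter_congr fun x hx => ?_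
      rw [← key.2.1 j' hj' x (Finset.mem_range.1 hx)]
      rfl
  · rintro y hy S' ⟨h1, h2, h3⟩
    have hidx : (idx j (.var 2)).eval I S' (Function.update v 2 y) = I 0 * J + y := by
      rw [eval_idx hf, hj S' _ (by simp)]
      simp
    have hval : (HExpr.or ((HExpr.var 2).eq (.var 1))
        (.read 8 (idx (.var 1) (.var 2)))).ind.eval I S' (Function.update v 2 y) ≠ 0 ↔
        y = i ∨ S 8 (I 0 * i + y) ≠ 0 := by
      rw [eval_ind]
      simp [hi, h2 i hiJ.ne y hy, or_iff_not_imp_left]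
    simp only [Cmd.denote, hidx, Mem.set]
    refine ⟨fun x hx => ?_, fun j' hj' x hx => ?_, fun a ha => ?_⟩
    · rw [Function.update_self]
      rcases Nat.lt_succ_iff_lt_or_eq.1 hx with hx' | rfl
      · rw [Function.update_of_ne (by omega)]
        exact h1 x hx'
      · rw [Function.update_self]
        exact hval
    · rw [Function.update_self, Function.update_of_ne fun h => hj' (idx_inj hx hy h).1]
      exact h2 j' hj' x hx
    · rw [Function.update_of_ne ha]
      exact h3 a ha

/-- The state of the dynamic program after the computation for all numbers below `J`. -/
structure Best (I : ℕ → ℕ) (S₀ : Mem) (J : ℕ) (S : Mem) : Prop where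
  frame : ∀ a, a ≠ 7 → a ≠ 8 → S a = S₀ a
  best : ∀ j < J, (posGraph I (S₀ 6)).IsBestPrefix (I 0) j (rowSet I S j) (S 7 j)
  later : ∀ j ≥ J, rowSet I S j = ∅

/-- Row `J` starts empty by `Best.later`. During the loop its set has the recorded value, which is
at least that of the empty set and of every candidate tried so far; `isBestPrefix_of_le` concludes.
-/
theorem best_bestStep {S₀ : Mem} (hG : (posGraph I (S₀ 6)).IsTournamentOn (I 0))
    (hS₀ : Listed I S₀) {J : ℕ} (h : Best I S₀ J S) {j : HExpr} (hj : IsBound I j v J)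
    (hf : j.Fresh 99) : Best I S₀ (J + 1) ((bestStep j).denote I v S) := by
  classical
  have hl : ∀ S' : Mem, (∀ a, a ≠ 7 → a ≠ 8 → S' a = S₀ a) → Listed I S' := by
    intro S' h' i hi
    rw [h' 6 (by norm_num) (by norm_num)]
    exact hS₀ i hi
  have hj' : ∀ S' i, j.eval I S' (Function.update v 1 i) = J := fun S' i => hj S' _ (by simp)
  have key := Cmd.iter_induction (I := I) (x := 1) (S := (Cmd.write 7 j (below j)).denote I v S)
    (v := v) (p := improve j)
    (fun i S' => (∀ a, a ≠ 7 → a ≠ 8 → S' a = S₀ a) ∧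
      (∀ j < J, (posGraph I (S₀ 6)).IsBestPrefix (I 0) j (rowSet I S' j) (S' 7 j)) ∧
      (∀ j > J, rowSet I S' j = ∅) ∧
      rowSet I S' J ⊆ (posGraph I (S₀ 6)).unaffected (I 0) ∧ rowSet I S' J ⊆ Finset.range J ∧
      (posGraph I (S₀ 6)).prefixValue (I 0) J (rowSet I S' J) = S' 7 J ∧
      (posGraph I (S₀ 6)).prefixValue (I 0) J ∅ ≤ S' 7 J ∧
      ∀ i' ∈ (posGraph I (S₀ 6)).unaffected (I 0), i' < i → i' < J →
        S' 7 i' + 1 + ((posGraph I (S₀ 6)).arcsBetween (I 0) i' J).card ≤ S' 7 J) ?_ ?_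
  · obtain ⟨h1, h2, h3, h4, h5, h6, h7, h8⟩ := key
    refine ⟨h1, fun i hi => ?_, fun i hi => h3 i hi⟩
    rcases Nat.lt_succ_iff_lt_or_eq.1 hi with hi' | rfl
    · exact h2 i hi'
    · exact isBestPrefix_of_le hG h2 h4 h5 h6 h7 fun i' hi' hlt =>
        h8 i' hi' (Finset.mem_range.1 (Finset.filter_subset _ _ hi')) hlt
  · have hval : (below j).eval I S v = (posGraph I (S₀ 6)).prefixValue (I 0) J ∅ := by
      rw [eval_below (hl S h.frame) hj, h.frame 6 (by norm_num) (by norm_num)]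
    have hrow : ∀ i, rowSet I ((Cmd.write 7 j (below j)).denote I v S) i = rowSet I S i :=
      fun i => rfl
    have h7 : (Cmd.write 7 j (below j)).denote I v S 7 =
        Function.update (S 7) J ((posGraph I (S₀ 6)).prefixValue (I 0) J ∅) := by
      simp only [Cmd.denote, Mem.set, hval, hj S v rfl, Function.update_self]
    have hemp := h.later J le_rfl
    refine ⟨fun a ha ha' => ?_, fun i hi => ?_, fun i hi => ?_, ?_, ?_, ?_, ?_, ?_⟩
    · simp only [Cmd.denote, Mem.set, Function.update_of_ne ha]
      exact h.frame a ha ha'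
    · rw [hrow, h7, Function.update_of_ne hi.ne]
      exact h.best i hi
    · rw [hrow]
      exact h.later i (le_of_lt hi)
    · rw [hrow, hemp]
      exact Finset.empty_subset _
    · rw [hrow, hemp]
      exact Finset.empty_subset _
    · rw [hrow, hemp, h7, Function.update_self]
    · rw [h7, Function.update_self]
    · intro i' _ hlt
      omega
  · rintro i hi S' ⟨h1, h2, h3, h4, h5, h6, h7, h8⟩
    have hl' := hl S' h1
    have hcand : (candidate j).eval I S' (Function.update v 1 i) =
        S' 7 i + 1 + ((posGraph I (S₀ 6)).arcsBetween (I 0) i J).card := by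
      rw [candidate, eval_add, eval_between hl' (J := J) (fun S'' v' hv' => hj S'' v' (by simpa using hv')),
        h1 6 (by norm_num) (by norm_num)]
      simp
    have hcond : (((HExpr.var 1).lt j).and ((free (.var 1)).and
        ((HExpr.read 7 j).lt (candidate j)))).Holds I S' (Function.update v 1 i) ↔
        i < J ∧ i ∈ (posGraph I (S₀ 6)).unaffected (I 0) ∧
          S' 7 J < S' 7 i + 1 + ((posGraph I (S₀ 6)).arcsBetween (I 0) i J).card := by
      rw [holds_and, holds_and, holds_lt, holds_lt, hcand, hj', eval_read, hj',
        holds_free hl' (by norm_num) (by norm_num) (by simpa using hi),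
        h1 6 (by norm_num) (by norm_num)]
      simp
    rw [improve, Cmd.denote_ite, if_congr hcond rfl rfl]
    split_ifs with hc
    · obtain ⟨hiJ, hiU, hlt⟩ := hc
      set S₁ := (Cmd.write 7 j (candidate j)).denote I (Function.update v 1 i) S' with hS₁
      have hrow₁ : ∀ i, rowSet I S₁ i = rowSet I S' i := fun i => rfl
      have h7₁ : S₁ 7 = Function.update (S' 7) J
          (S' 7 i + 1 + ((posGraph I (S₀ 6)).arcsBetween (I 0) i J).card) := by
        simp only [hS₁, Cmd.denote, Mem.set, hcand, hj', Function.update_self]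
      obtain ⟨g1, g2, g3⟩ := denote_copyRow (I := I) (S := S₁) (v := Function.update v 1 i)
        (j := j) (J := J) (i := i) (fun S'' v' hv' => hj S'' v' (by simpa using hv')) hf (by simp)
        hiJ hi
      rw [Cmd.denote, ← hS₁]
      set S₂ := (copyRow j).denote I (Function.update v 1 i) S₁
      have h72 : ∀ i' < J, S₂ 7 i' = S' 7 i' := by
        intro i' hi'
        rw [g3 7 (by norm_num), h7₁, Function.update_of_ne hi'.ne]
      have h7J : S₂ 7 J = S' 7 i + 1 + ((posGraph I (S₀ 6)).arcsBetween (I 0) i J).card := by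
        rw [g3 7 (by norm_num), h7₁, Function.update_self]
      have hri := h2 i hiJ
      refine ⟨fun a ha ha' => ?_, fun i' hi' => ?_, fun i' hi' => ?_, ?_, ?_, ?_, ?_, ?_⟩
      · rw [g3 a ha', hS₁]
        simp only [Cmd.denote, Mem.set, Function.update_of_ne ha]
        exact h1 a ha ha'
      · rw [g2 i' hi'.ne, hrow₁, h72 i' hi']
        exact h2 i' hi'
      · rw [g2 i' (ne_of_gt hi'), hrow₁]
        exact h3 i' hi'
      · rw [g1, hrow₁]
        exact Finset.insert_subset hiU hri.subset
      · rw [g1, hrow₁]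
        exact Finset.insert_subset (Finset.mem_range.2 hiJ)
          (hri.lt.trans (Finset.range_subset_range.2 hiJ.le))
      · rw [g1, hrow₁, h7J, prefixValue_insert hG hri.lt hiU hiJ, hri.value]
      · rw [h7J]
        omega
      · intro i' hU hi' hJ'
        rw [h72 i' hJ', h7J]
        rcases Nat.lt_succ_iff_lt_or_eq.1 hi' with hlt' | rfl
        · have := h8 i' hU hlt' hJ'
          omega
        · exact le_rfl
    · refine ⟨h1, h2, h3, h4, h5, h6, h7, fun i' hU hi' hJ' => ?_⟩
      rcases Nat.lt_succ_iff_lt_or_eq.1 hi' with hlt' | rfl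
      · exact h8 i' hU hlt' hJ'
      · by_contra hcon
        exact hc ⟨hJ', hU, not_le.1 hcon⟩

theorem isOptimal_best {S₀ : Mem} (hG : (posGraph I (S₀ 6)).IsTournamentOn (I 0))
    (hS₀ : Listed I S₀) (h8 : S₀ 8 = fun _ => 0) :
    (posGraph I (S₀ 6)).IsOptimal (I 0) (rowSet I (best.denote I v S₀) (I 0)) ∧
      ∀ a, a ≠ 7 → a ≠ 8 → best.denote I v S₀ a = S₀ a := by
  have h1 := Cmd.iter_induction (I := I) (x := 0) (p := bestStep (.var 0)) (S := S₀) (v := v)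
    (fun J S => Best I S₀ J S)
    ⟨fun _ _ _ => rfl, fun _ h => absurd h (by omega), fun j _ => by simp [rowSet, h8]⟩
    (fun J _ S hS => best_bestStep hG hS₀ hS
      (fun S' v' hv' => by simpa using hv') (by simp))
  have h2 : Best I S₀ (I 0 + 1) (best.denote I v S₀) :=
    best_bestStep hG hS₀ h1 (fun _ _ _ => rfl) (by simp)
  exact ⟨(h2.best (I 0) (by omega)).isOptimal hG, h2.frame⟩

end RAM.Kernel

namespace RAM.Kernel

open HExpr Digraph

variable {I : ℕ → ℕ} {S : Mem} {v : ℕ → ℕ} {a b : HExpr}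

/-! ## The program: output

Array `9` lists the vertices of the reduced tournament, and the output is written to array `0`. -/

def selected (a : HExpr) : HExpr := .read 8 (idx (.inp (.const 0)) a)

def spans (a b : HExpr) : HExpr :=
  count 12 ((selected (.var 12)).and ((a.lt (.var 12)).and ((HExpr.var 12).lt b)))

def spanningCount : HExpr :=
  count₂ 10 11 ((back (.var 10) (.var 11)).and (spans (.var 10) (.var 11)))

def freeCount : HExpr := count 1 ((free (.var 1)).and (selected (.var 1)).not)

/-- Yes is certain if the greedy triangles, or the triangles from the two matchings, are at least
`k` in number. -/
def enough : HExpr :=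
  ((HExpr.read 2 (.const 0)).lt (.inp (.const 1))).not.or
    ((HExpr.add spanningCount freeCount).lt (.inp (.const 1))).not

def reducedAdj (a b : HExpr) : HExpr :=
  ((a.lt b).and ((posAdj a b).or (spans a b))).or
    ((b.lt a).and ((posAdj a b).and (spans b a).not))

/-- A triangle, with parameter `1`. -/
def writeTriangle : Cmd :=
  -- Cells 3, 7, 8 are the matrix entries 1, 5, 6, that is, the arcs `(0, 1)`, `(1, 2)`, `(2, 0)`.
  .seq (.write 0 (.const 0) (.const 3)) (.seq (.write 0 (.const 1) (.const 1))
    (.seq (.write 0 (.const 3) (.const 1)) (.seq (.write 0 (.const 7) (.const 1))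
      (.write 0 (.const 8) (.const 1)))))

def listKept : Cmd :=
  .iter 0 (.ite (selected (.var 0)).not
    (.write 9 (count 1 (((HExpr.var 1).lt (.var 0)).and (selected (.var 1)).not)) (.var 0)) .skip)

/-- Rows of the output have length `N`, the number of kept vertices, instead of `n`. As `N ≤ n`, the
product with `N` is a sum over `n` terms cut off at `N`. -/
def entry : HExpr :=
  .add (.const 2) (.add (.sum 99 (.ite ((HExpr.var 99).lt (.read 0 (.const 0))) (.var 0)
    (.const 0))) (.var 1))

def writeEntry : Cmd :=
  .ite (((HExpr.var 0).lt (.read 0 (.const 0))).and ((HExpr.var 1).lt (.read 0 (.const 0))))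
    (.write 0 entry (reducedAdj (.read 9 (.var 0)) (.read 9 (.var 1))).ind) .skip

def writeReduced : Cmd :=
  .seq listKept (.seq (.write 0 (.const 0) (count 1 (selected (.var 1)).not))
    (.seq (.write 0 (.const 1) (.sub (.inp (.const 1)) spanningCount))
      (.iter 0 (.iter 1 writeEntry))))

def output : Cmd := .ite enough writeTriangle writeReduced

def kernelize : Cmd := .seq pack (.seq order (.seq sort (.seq best output)))

/-! ### Correctness of the output -/

/-- The selected set is stored in row `n` of array `8`. -/
def Selected (I : ℕ → ℕ) (S : Mem) (T : Finset ℕ) : Prop :=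
  ∀ x < I 0, S 8 (I 0 * I 0 + x) ≠ 0 ↔ x ∈ T

theorem selected_rowSet : Selected I S (rowSet I S (I 0)) := by
  intro x hx
  simp [rowSet, hx]

variable {T : Finset ℕ}

theorem holds_selected (hT : Selected I S T) (ha : a.eval I S v < I 0) :
    (selected a).Holds I S v ↔ a.eval I S v ∈ T := by
  rw [selected, holds_read, eval_idx (by simp)]
  exact hT _ ha

theorem holds_spans (hT : Selected I S T) (hTn : T ⊆ Finset.range (I 0)) (ha : a.Fresh 12)
    (hb : b.Fresh 12) : (spans a b).Holds I S v ↔ Spans T (a.eval I S v) (b.eval I S v) := by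
  rw [spans, holds_count]
  constructor
  · rintro ⟨w, hw, h⟩
    rw [holds_and, holds_and, holds_selected hT (by simpa using hw), holds_lt, holds_lt, ha, hb] at h
    exact ⟨w, by simpa using h⟩
  · rintro ⟨w, hw, h⟩
    have hwn := Finset.mem_range.1 (hTn hw)
    refine ⟨w, hwn, ?_⟩
    rw [holds_and, holds_and, holds_selected hT (by simpa using hwn), holds_lt, holds_lt, ha, hb]
    simpa using ⟨hw, h⟩

theorem eval_spanningCount (hS : Listed I S) (hT : Selected I S T) (hTn : T ⊆ Finset.range (I 0)) :
    spanningCount.eval I S v = ((posGraph I (S 6)).spanning (I 0) T).card := by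
  classical
  rw [spanningCount, eval_count₂_back hS _ (Spans T), spanning]
  intro x y
  rw [holds_spans hT hTn] <;> simp

theorem eval_freeCount (hS : Listed I S) (hT : Selected I S T) :
    freeCount.eval I S v = ((posGraph I (S 6)).unaffected (I 0) \ T).card := by
  classical
  rw [freeCount, eval_count]
  congr 1
  ext x
  rw [Finset.mem_filter, Finset.mem_range, Finset.mem_sdiff, holds_and, holds_not]
  constructor
  · rintro ⟨hx, h1, h2⟩
    rw [holds_free hS (by norm_num) (by norm_num) (by simpa using hx)] at h1
    rw [holds_selected hT (by simpa using hx)] at h2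
    simpa using ⟨h1, h2⟩
  · rintro ⟨h1, h2⟩
    have hx : x < I 0 := Finset.mem_range.1 (Finset.filter_subset _ _ h1)
    rw [holds_free hS (by norm_num) (by norm_num) (by simpa using hx),
      holds_selected hT (by simpa using hx)]
    simpa using ⟨hx, h1, h2⟩

theorem holds_reducedAdj (hS : Listed I S) (hT : Selected I S T) (hTn : T ⊆ Finset.range (I 0))
    (ha : a.Fresh 12) (hb : b.Fresh 12) (ha' : a.Fresh 99)
    (han : a.eval I S v < I 0) (hbn : b.eval I S v < I 0) (haT : a.eval I S v ∉ T)
    (hbT : b.eval I S v ∉ T) : (reducedAdj a b).Holds I S v ↔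
      ((posGraph I (S 6)).reduce (I 0) T).Adj (a.eval I S v) (b.eval I S v) := by
  rw [reducedAdj, holds_or, holds_and, holds_and, holds_or, holds_and, holds_not, holds_lt,
    holds_lt, holds_posAdj hS ha' han hbn, holds_spans hT hTn ha hb, holds_spans hT hTn hb ha]
  simp [reduce, han, hbn, haT, hbT]

/-- `f` lists the numbers below `n` that are not in `T`. -/
structure Lists (n : ℕ) (T : Finset ℕ) (f : ℕ → ℕ) : Prop where
  mem : ∀ x < (Finset.range n \ T).card, f x < n ∧ f x ∉ T
  inj : ∀ x < (Finset.range n \ T).card, ∀ y < (Finset.range n \ T).card, f x = f y → x = y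
  surj : ∀ u < n, u ∉ T → ∃ x < (Finset.range n \ T).card, f x = u

theorem lists_of_rank {n : ℕ} {f : ℕ → ℕ}
    (h : ∀ u < n, u ∉ T → f ((Finset.range u \ T).card) = u) : Lists n T f := by
  set r : ℕ → ℕ := fun u => (Finset.range u \ T).card
  have hmaps : Set.MapsTo r ((Finset.range n \ T : Finset ℕ) : Set ℕ)
      (Finset.range (Finset.range n \ T).card) := by
    intro u hu
    rw [Finset.mem_coe, Finset.mem_sdiff, Finset.mem_range] at hu
    rw [Finset.mem_coe, Finset.mem_range]
    refine Finset.card_lt_card ⟨Finset.sdiff_subset_sdiff (Finset.range_subset_range.2 hu.1.le)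
      subset_rfl, fun hsub => ?_⟩
    have := hsub (Finset.mem_sdiff.2 ⟨Finset.mem_range.2 hu.1, hu.2⟩)
    simp at this
  have hinj : Set.InjOn r ((Finset.range n \ T : Finset ℕ) : Set ℕ) := by
    intro u hu w hw huw
    rw [Finset.mem_coe, Finset.mem_sdiff, Finset.mem_range] at hu hw
    rw [← h u hu.1 hu.2, ← h w hw.1 hw.2]
    exact congrArg f huw
  have hsurj : ∀ x < (Finset.range n \ T).card, ∃ u, (u < n ∧ u ∉ T) ∧ r u = x := by
    intro x hx
    obtain ⟨u, hu, hux⟩ := Finset.surjOn_of_injOn_of_card_le r hmaps hinj (by simp)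
      (Finset.mem_coe.2 (Finset.mem_range.2 hx))
    rw [Finset.mem_coe, Finset.mem_sdiff, Finset.mem_range] at hu
    exact ⟨u, hu, hux⟩
  refine ⟨fun x hx => ?_, fun x hx y hy hxy => ?_, fun u hu huT => ⟨r u, ?_, h u hu huT⟩⟩
  · obtain ⟨u, hu, rfl⟩ := hsurj x hx
    rwa [h u hu.1 hu.2]
  · obtain ⟨u, hu, rfl⟩ := hsurj x hx
    obtain ⟨w, hw, rfl⟩ := hsurj y hy
    rw [h u hu.1 hu.2, h w hw.1 hw.2] at hxy
    rw [hxy]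
  · exact Finset.mem_range.1 (hmaps (Finset.mem_coe.2 (Finset.mem_sdiff.2
      ⟨Finset.mem_range.2 hu, huT⟩)))

theorem lists_listKept (hT : Selected I S T) :
    Lists (I 0) T (listKept.denote I v S 9) ∧ ∀ a ≠ 9, listKept.denote I v S a = S a := by
  classical
  have key := Cmd.iter_induction (I := I) (x := 0) (S := S) (v := v)
    (p := .ite (selected (.var 0)).not
      (.write 9 (count 1 (((HExpr.var 1).lt (.var 0)).and (selected (.var 1)).not)) (.var 0)) .skip)
    (fun i S' => (∀ u < i, u ∉ T → S' 9 ((Finset.range u \ T).card) = u) ∧ ∀ a ≠ 9, S' a = S a)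
    ⟨fun _ h => absurd h (by omega), fun _ _ => rfl⟩ ?_
  · exact ⟨lists_of_rank key.1, key.2⟩
  rintro i hi S' ⟨h1, h2⟩
  have hT' : Selected I S' T := by
    intro x hx
    rw [h2 8 (by norm_num)]
    exact hT x hx
  have hc : (selected (.var 0)).not.Holds I S' (Function.update v 0 i) ↔ i ∉ T := by
    rw [holds_not, holds_selected hT' (by simpa using hi)]
    simp
  rw [Cmd.denote_ite, if_congr hc rfl rfl]
  by_cases hiT : i ∉ T
  · rw [if_pos hiT]
    have hval : (count 1 (((HExpr.var 1).lt (.var 0)).and (selected (.var 1)).not)).eval I S'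
        (Function.update v 0 i) = (Finset.range i \ T).card := by
      rw [eval_count]
      congr 1
      ext x
      rw [Finset.mem_filter, Finset.mem_range, Finset.mem_sdiff, Finset.mem_range, holds_and,
        holds_not, holds_lt]
      constructor
      · rintro ⟨hx, h3, h4⟩
        rw [holds_selected hT' (by simpa using hx)] at h4
        simpa using ⟨h3, h4⟩
      · rintro ⟨h3, h4⟩
        rw [holds_selected hT' (by simpa using h3.trans hi)]
        simpa using ⟨h3.trans hi, h3, h4⟩
    simp only [Cmd.denote, hval, Mem.set, eval_var, Function.update_self]
    refine ⟨fun u hu huT => ?_, fun a ha => by rw [Function.update_of_ne ha, h2 a ha]⟩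
    rcases Nat.lt_succ_iff_lt_or_eq.1 hu with hu' | rfl
    · rw [Function.update_of_ne, h1 u hu' huT]
      refine ne_of_lt (Finset.card_lt_card ⟨Finset.sdiff_subset_sdiff
        (Finset.range_subset_range.2 hu'.le) subset_rfl, fun hsub => ?_⟩)
      have := hsub (Finset.mem_sdiff.2 ⟨Finset.mem_range.2 hu', huT⟩)
      simp at this
    · rw [Function.update_self]
  · rw [if_neg hiT]
    refine ⟨fun u hu huT => ?_, h2⟩
    rcases Nat.lt_succ_iff_lt_or_eq.1 hu with hu' | rfl
    · exact h1 u hu' huT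
    · exact absurd huT hiT

/-- The instance with the reduced tournament. -/
theorem exists_reducedInstance {G : Digraph ℕ} {n : ℕ} (hG : G.IsTournamentOn n) {f : ℕ → ℕ}
    (hf : Lists n T f) {k : ℕ} (hk : 0 < k) :
    ∃ J : ACTInstance, J.n = (Finset.range n \ T).card ∧ J.k = k ∧
      (∀ x y (hx : x < J.n) (hy : y < J.n),
        J.T.Adj ⟨x, hx⟩ ⟨y, hy⟩ ↔ (G.reduce n T).Adj (f x) (f y)) ∧
      (J.IsYes ↔ (G.reduce n T).HasArcDisjointCycles k) := by
  let K : Digraph (Fin (Finset.range n \ T).card) :=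
    ⟨fun x y => (G.reduce n T).Adj (f x) (f y)⟩
  have hK : K.IsTournament := by
    refine ⟨fun u h => ?_, fun x y hxy => ?_⟩
    · rcases h.2.2 with h | h
      · exact lt_irrefl _ h.1
      · exact lt_irrefl _ h.1
    · have hne : f x ≠ f y := fun h => hxy (Fin.ext (hf.inj x x.2 y y.2 h))
      have hx := hf.mem x x.2
      have hy := hf.mem y y.2
      have htot := hG.total _ hx.1 _ hy.1 hne
      have ha1 := hG.asymm (f x) (f y)
      simp only [K, reduce, hx, hy, not_false_eq_true, and_self, true_and]
      -- Across a vertex of `T` the arc always points forward; elsewhere it is the arc of `G`.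
      rcases lt_or_gt_of_ne hne with h | h
      · simp only [h, not_lt_of_gt h, true_and, false_and, or_false, false_or, Xor]
        tauto
      · simp only [h, not_lt_of_gt h, true_and, false_and, or_false, false_or, Xor]
        tauto
  refine ⟨⟨_, K, hK, k, hk⟩, rfl, rfl, fun _ _ _ _ => Iff.rfl, ?_⟩
  refine hasArcDisjointCycles_iff_of_map (fun x : Fin _ => f x)
    (fun x y h => Fin.ext (hf.inj x x.2 y y.2 h)) (fun _ _ => Iff.rfl) (fun u w h => ?_) _
  obtain ⟨x, hx, rfl⟩ := hf.surj u h.1.1 h.2.1.1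
  exact ⟨⟨x, hx⟩, rfl⟩

theorem eval_entry {N : ℕ} (hN : N ≤ I 0) (h0 : S 0 0 = N) :
    entry.eval I S v = 2 + (N * v 0 + v 1) := by
  classical
  have h : (HExpr.sum 99 (.ite ((HExpr.var 99).lt (.read 0 (.const 0))) (.var 0)
      (.const 0))).eval I S v = N * v 0 := by
    have hfil : (Finset.range (I 0)).filter (fun z => z < N) = Finset.range N := by
      ext z
      simp only [Finset.mem_filter, Finset.mem_range]
      omega
    rw [HExpr.eval]
    simp only [eval_ite', holds_lt, eval_var, Function.update_self, eval_read, eval_const, h0,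
      Function.update_of_ne (show (0 : ℕ) ≠ 99 by norm_num)]
    rw [← Finset.sum_filter, hfil]
    simp
  rw [entry, eval_add, eval_add, h]
  simp

/-- The part of the output that is specified after the entries in `P` have been written. -/
structure Written (I : ℕ → ℕ) (S₀ : Mem) (T : Finset ℕ) (N k : ℕ) (P : ℕ → ℕ → Prop) (S : Mem) :
    Prop where
  frame : ∀ a ≠ 0, S a = S₀ a
  zero : S 0 0 = N
  one : S 0 1 = k
  le : ∀ q, S 0 (2 + q) ≤ 1
  entry : ∀ x < N, ∀ y < N, P x y → (S 0 (2 + (N * x + y)) ≠ 0 ↔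
    ((posGraph I (S₀ 6)).reduce (I 0) T).Adj (S₀ 9 x) (S₀ 9 y))
  rest : ∀ q, N * N ≤ q → S 0 (2 + q) = 0

theorem Written.mono {S₀ : Mem} {N k : ℕ} {P P' : ℕ → ℕ → Prop} (h : Written I S₀ T N k P S)
    (hP : ∀ x < N, ∀ y < N, P' x y → P x y) : Written I S₀ T N k P' S :=
  ⟨h.frame, h.zero, h.one, h.le, fun x hx y hy hp => h.entry x hx y hy (hP x hx y hy hp), h.rest⟩

theorem written_writeEntry {S₀ : Mem} {k : ℕ} {P : ℕ → ℕ → Prop} (hS : Listed I S₀)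
    (hT : Selected I S₀ T) (hTn : T ⊆ Finset.range (I 0)) (hL : Lists (I 0) T (S₀ 9))
    (h : Written I S₀ T (Finset.range (I 0) \ T).card k P S) {i j : ℕ} (hi : v 0 = i)
    (hj : v 1 = j) :
    Written I S₀ T (Finset.range (I 0) \ T).card k (fun x y => P x y ∨ x = i ∧ y = j)
      (writeEntry.denote I v S) := by
  classical
  set N := (Finset.range (I 0) \ T).card with hN
  have hNn : N ≤ I 0 := (Finset.card_le_card Finset.sdiff_subset).trans (Finset.card_range _).le
  have hS' : Listed I S := by
    intro x hx
    rw [h.frame 6 (by norm_num)]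
    exact hS x hx
  have hT' : Selected I S T := by
    intro x hx
    rw [h.frame 8 (by norm_num)]
    exact hT x hx
  have hc : (((HExpr.var 0).lt (.read 0 (.const 0))).and
      ((HExpr.var 1).lt (.read 0 (.const 0)))).Holds I S v ↔ i < N ∧ j < N := by
    simp [h.zero, hi, hj]
  rw [writeEntry, Cmd.denote_ite, if_congr hc rfl rfl]
  split_ifs with hij
  · have h9 := h.frame 9 (by norm_num)
    have hmi := hL.mem i hij.1
    have hmj := hL.mem j hij.2
    have hval : (reducedAdj (.read 9 (.var 0)) (.read 9 (.var 1))).Holds I S v ↔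
        ((posGraph I (S₀ 6)).reduce (I 0) T).Adj (S₀ 9 i) (S₀ 9 j) := by
      rw [holds_reducedAdj hS' hT' hTn] <;> simp [hi, hj, h9, hmi, hmj, h.frame 6]
    have hidx : entry.eval I S v = 2 + (N * i + j) := by
      rw [eval_entry hNn h.zero, hi, hj]
    simp only [Cmd.denote, Mem.set, hidx, eval_ind, hval]
    refine ⟨fun a ha => ?_, ?_, ?_, fun q => ?_, fun x hx y hy hp => ?_, fun q hq => ?_⟩
    · rw [Function.update_of_ne ha, h.frame a ha]
    · rw [Function.update_self, Function.update_of_ne (by omega), h.zero]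
    · rw [Function.update_self, Function.update_of_ne (by omega), h.one]
    · rw [Function.update_self, Function.update_apply]
      split_ifs
      · exact le_rfl
      · exact Nat.zero_le _
      · exact h.le q
    · rw [Function.update_self]
      by_cases hxy : x = i ∧ y = j
      · obtain ⟨rfl, rfl⟩ := hxy
        rw [Function.update_self]
        split_ifs with hr <;> simp [hr]
      · rw [Function.update_of_ne fun heq => hxy (idx_inj hy hij.2 (by omega))]
        exact h.entry x hx y hy (hp.resolve_right hxy)
    · have : N * i + j < N * N := by nlinarith [hij.1, hij.2]
      rw [Function.update_self, Function.update_of_ne (by omega)]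
      exact h.rest q hq
  · refine ⟨h.frame, h.zero, h.one, h.le, fun x hx y hy hp => ?_, h.rest⟩
    refine h.entry x hx y hy (hp.resolve_right ?_)
    rintro ⟨rfl, rfl⟩
    exact hij ⟨hx, hy⟩

theorem written_writeReduced (hS : Listed I S) (hT : Selected I S T)
    (hTn : T ⊆ Finset.range (I 0)) (h0 : S 0 = fun _ => 0) :
    ∃ S₁, (∀ a ≠ 9, S₁ a = S a) ∧ Lists (I 0) T (S₁ 9) ∧
      Written I S₁ T (Finset.range (I 0) \ T).card
        (I 1 - ((posGraph I (S 6)).spanning (I 0) T).card) (fun _ _ => True)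
        (writeReduced.denote I v S) := by
  classical
  obtain ⟨hL, hfr⟩ := lists_listKept (v := v) hT
  set S₁ := listKept.denote I v S with hS₁
  set N := (Finset.range (I 0) \ T).card with hN
  set k := I 1 - ((posGraph I (S 6)).spanning (I 0) T).card with hk
  have hNn : N ≤ I 0 := (Finset.card_le_card Finset.sdiff_subset).trans (Finset.card_range _).le
  have hSel : ∀ S' : Mem, S' 8 = S 8 → Selected I S' T := by
    intro S' h x hx
    rw [h]
    exact hT x hx
  have hLis : ∀ S' : Mem, S' 6 = S 6 → Listed I S' := by
    intro S' h x hx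
    rw [h]
    exact hS x hx
  refine ⟨S₁, hfr, hL, ?_⟩
  have hNval : (count 1 (selected (.var 1)).not).eval I S₁ v = N := by
    rw [eval_count]
    congr 1
    ext x
    rw [Finset.mem_filter, Finset.mem_range, Finset.mem_sdiff, Finset.mem_range]
    refine and_congr_right fun hx => ?_
    rw [holds_not, holds_selected (hSel _ (hfr 8 (by norm_num))) (by simpa using hx)]
    simp
  set S₂ := (Cmd.write 0 (.const 0) (count 1 (selected (.var 1)).not)).denote I v S₁ with hS₂
  have hS₂' : S₂ = S₁.set 0 0 N := by
    simp only [hS₂, Cmd.denote, hNval, eval_const]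
  have hfr₂ : ∀ a ≠ 0, S₂ a = S₁ a := by
    intro a ha
    rw [hS₂', Mem.set, Function.update_of_ne ha]
  have hkval : (HExpr.sub (.inp (.const 1)) spanningCount).eval I S₂ v = k := by
    have h6 : S₂ 6 = S 6 := (hfr₂ 6 (by norm_num)).trans (hfr 6 (by norm_num))
    have h8 : S₂ 8 = S 8 := (hfr₂ 8 (by norm_num)).trans (hfr 8 (by norm_num))
    rw [eval_sub, eval_spanningCount (hLis _ h6) (hSel _ h8) hTn, h6]
    rfl
  set S₃ := (Cmd.write 0 (.const 1) (.sub (.inp (.const 1)) spanningCount)).denote I v S₂ with hS₃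
  have hS₃' : S₃ = S₂.set 0 1 k := by
    simp only [hS₃, Cmd.denote, hkval, eval_const]
  have h30 : ∀ q, S₃ 0 q = if q = 1 then k else if q = 0 then N else 0 := by
    intro q
    rw [hS₃', hS₂']
    simp [Mem.set, Function.update_apply, hfr 0, h0]
  have hinit : Written I S₁ T N k (fun x _ => x < 0) S₃ := by
    refine ⟨fun a ha => ?_, ?_, ?_, fun q => ?_, fun x _ y _ h => absurd h (by omega),
      fun q _ => ?_⟩
    · rw [hS₃', Mem.set, Function.update_of_ne ha, hfr₂ a ha]
    · simp [h30]
    · simp [h30]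
    · rw [h30, if_neg (by omega), if_neg (by omega)]
      exact Nat.zero_le _
    · rw [h30, if_neg (by omega), if_neg (by omega)]
  have hL1 : Listed I S₁ := hLis _ (hfr 6 (by norm_num))
  have hT1 : Selected I S₁ T := hSel _ (hfr 8 (by norm_num))
  have h1 := Cmd.iter_induction (I := I) (x := 0) (p := .iter 1 writeEntry) (v := v)
    (fun i S => Written I S₁ T N k (fun x _ => x < i) S) hinit ?_
  · exact h1.mono fun x hx _ _ _ => by omega
  intro i hi S' hS'
  have h2 := Cmd.iter_induction (I := I) (x := 1) (p := writeEntry)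
    (v := Function.update v 0 i)
    (fun j S => Written I S₁ T N k (fun x y => x < i ∨ x = i ∧ y < j) S) (hS'.mono ?_) ?_
  · exact h2.mono fun x _ y hy h => by omega
  · intro x _ y _ h
    omega
  intro j hj S'' hS''
  refine (written_writeEntry hL1 hT1 hTn hL hS'' (i := i) (j := j) ?_ ?_).mono ?_
  · simp
  · simp
  · intro x _ y _ h
    omega

/-- The yes-instance consisting of a triangle and the parameter `1`. -/
theorem exists_triangleInstance (h0 : S 0 = fun _ => 0) :
    ∃ J : ACTInstance, J.n = 3 ∧ J.k = 1 ∧ J.IsYes ∧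
      writeTriangle.denote I v S 0 = arrayOf J.encode := by
  let K : Digraph (Fin 3) := ⟨fun x y => y = x + 1⟩
  have hK : K.IsTournament := by
    refine ⟨fun u => ?_, fun u w => ?_⟩
    · simp only [K]; revert u; decide
    · simp only [K, Xor]; revert u w; decide
  refine ⟨⟨3, K, hK, 1, one_pos⟩, rfl, rfl, ?_, ?_⟩
  · exact hasArcDisjointCycles_of_card (ι := Unit) (by simp) (fun _ => [0, 1, 2])
      (fun _ => isCycle_triangle hK.loopless
        (show (1 : Fin 3) = 0 + 1 by decide) (show (2 : Fin 3) = 1 + 1 by decide)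
        (show (0 : Fin 3) = 2 + 1 by decide)) (fun i j hij => absurd rfl hij)
  · have hval : ∀ q, writeTriangle.denote I v S 0 q =
        if q = 8 then 1 else if q = 7 then 1 else if q = 3 then 1 else if q = 1 then 1 else
          if q = 0 then 3 else 0 := by
      intro q
      simp [writeTriangle, Cmd.denote, Mem.set, Function.update_apply, h0]
    refine ACTInstance.eq_arrayOf_encode _ ?_ ?_ ?_ ?_ ?_
    · simp [hval]
    · simp [hval]
    · intro q
      rw [hval]
      split_ifs <;> omega
    · intro x y hx hy
      simp only [hval, K]
      change x < 3 at hx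
      change y < 3 at hy
      interval_cases x <;> interval_cases y <;> decide +revert
    · intro q hq
      change 3 * 3 ≤ q at hq
      rw [hval]
      split_ifs <;> omega

/-! ### Correctness of the whole program -/

/-- The program computes an equivalent instance with a linear number of vertices. -/
theorem kernelize_spec (A : ACTInstance) :
    ∃ J : ACTInstance, kernelize.denote (arrayOf A.encode) v (fun _ _ => 0) 0 = arrayOf J.encode ∧
      (A.IsYes ↔ J.IsYes) ∧ J.n ≤ 12 * A.k ∧ J.k ≤ A.k := by
  classical
  set I := arrayOf A.encode with hI
  have hI0 : I 0 = A.n := by simp [hI, arrayOf, ACTInstance.encode]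
  have hI1 : I 1 = A.k := by simp [hI, arrayOf, ACTInstance.encode]
  have hkpos := A.k_pos
  have hG : (inputGraph I).IsTournamentOn (I 0) := by
    rw [hI0]
    exact A.isTournamentOn_inputGraph
  have hyes : A.IsYes ↔ (inputGraph I).HasArcDisjointCycles A.k := A.isYes_iff
  obtain ⟨X, t, hpack, ht, hmarks, htri, hzero⟩ := packed_pack (I := I) (v := v)
  set S₁ := pack.denote I v fun _ _ => 0
  obtain ⟨hord, hinj⟩ := ordering_order (v := v) hG hmarks (fun a b c => htri a b c trivial)
    (hzero 3 (by norm_num) (by norm_num)) (hzero 4 (by norm_num) (by norm_num))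
  set S₂ := order.denote I v S₁
  obtain ⟨hsort, hfr₃⟩ := sorted_sort (I := I) (v := v) hinj
  set S₃ := sort.denote I v S₂
  have hP := hsort.isTournamentOn hG
  have hL₃ : Listed I S₃ := hsort.lt
  have hfr₂ : ∀ a, a ≠ 1 → a ≠ 2 → a ≠ 3 → a ≠ 4 → a ≠ 5 → a ≠ 6 → S₃ a = fun _ => 0 := by
    intro a h1 h2 h3 h4 h5 h6
    rw [hfr₃ a h6, hord.frame a h3 h4 h5, hzero a h1 h2]
  obtain ⟨hopt, hfr₄⟩ := isOptimal_best (v := v) hP hL₃ (hfr₂ 8 (by norm_num) (by norm_num)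
    (by norm_num) (by norm_num) (by norm_num) (by norm_num))
  set S₄ := best.denote I v S₃ with hS₄
  set T := rowSet I S₄ (I 0) with hTdef
  have h6 : S₄ 6 = S₃ 6 := hfr₄ 6 (by norm_num) (by norm_num)
  have h2 : S₄ 2 0 = t := by
    rw [hfr₄ 2 (by norm_num) (by norm_num), hfr₃ 2 (by norm_num),
      hord.frame 2 (by norm_num) (by norm_num) (by norm_num), ht]
  have h0 : S₄ 0 = fun _ => 0 := by
    rw [hfr₄ 0 (by norm_num) (by norm_num), hfr₂ 0 (by norm_num) (by norm_num)
      (by norm_num) (by norm_num) (by norm_num) (by norm_num)]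
  have hL₄ : Listed I S₄ := by
    intro i hi
    rw [h6]
    exact hL₃ i hi
  have hTn : T ⊆ Finset.range (I 0) := Finset.filter_subset _ _
  have hT : Selected I S₄ T := selected_rowSet
  have hback : ((posGraph I (S₃ 6)).backArcs (I 0)).card ≤ 5 * t :=
    hsort.card_backArcs_le.trans (hpack.card_backwardPairs_le
      (fun u hu w hw hne => hG.total u (Finset.mem_range.1 hu) w (Finset.mem_range.1 hw) hne)
      hord.le)
  have hiso := hsort.hasArcDisjointCycles_iff A.k
  have hrun : kernelize.denote I v (fun _ _ => 0) = output.denote I v S₄ := rfl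
  have henough : enough.Holds I S₄ v ↔ A.k ≤ t ∨
      A.k ≤ ((posGraph I (S₃ 6)).spanning (I 0) T).card +
        ((posGraph I (S₃ 6)).unaffected (I 0) \ T).card := by
    rw [enough, holds_or, holds_not, holds_not, holds_lt, holds_lt, eval_add,
      eval_spanningCount hL₄ hT hTn, eval_freeCount hL₄ hT, h6]
    simp [h2, hI1]
  rw [hrun, output, Cmd.denote_ite, if_congr henough rfl rfl]
  split_ifs with hk
  · obtain ⟨J, hJn, hJk, hJ, harr⟩ := exists_triangleInstance (I := I) (v := v) h0
    refine ⟨J, harr, ⟨fun _ => hJ, fun _ => hyes.2 ?_⟩, by omega, by omega⟩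
    rcases hk with hk | hk
    · exact (hpack.hasArcDisjointCycles hG.irrefl).mono hk
    · exact hiso.2 ((hopt.hasArcDisjointCycles hP).mono hk)
  · rw [not_or, not_le, not_le] at hk
    obtain ⟨S₅, hfr₅, hlists, hw⟩ := written_writeReduced (v := v) hL₄ hT hTn h0
    rw [h6, hI1] at hw
    have h65 : S₅ 6 = S₃ 6 := (hfr₅ 6 (by norm_num)).trans h6
    -- As the test `enough` failed, there are fewer than `k` spanning arcs and the new parameter is
    -- positive.
    obtain ⟨J, hJn, hJk, hJadj, hJ⟩ := exists_reducedInstance hP hlists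
      (k := A.k - ((posGraph I (S₃ 6)).spanning (I 0) T).card) (by omega)
    refine ⟨J, ?_, ?_, ?_, by omega⟩
    · refine J.eq_arrayOf_encode ?_ ?_ hw.le ?_ ?_
      · rw [hw.zero, hJn]
      · rw [hw.one, hJk]
      · intro x y hx hy
        rw [hJadj, ← h65, ← hw.entry x (hJn ▸ hx) y (hJn ▸ hy) trivial, hJn]
      · intro q hq
        rw [hJn] at hq
        exact hw.rest q hq
    · rw [hyes, hiso, hJ, ← hopt.reduce_iff hP,
        show A.k - ((posGraph I (S₃ 6)).spanning (I 0) T).card +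
          ((posGraph I (S₃ 6)).spanning (I 0) T).card = A.k by omega]
    -- The bound is `2 · 5t` plus the number of unaffected vertices outside `T`; both `t` and that
    -- number are at most `k - 1`.
    · have := card_le_of_backArcs (posGraph I (S₃ 6)) (I 0) T
      omega

end RAM.Kernel

theorem theorem5p2 :
    ∃ kernel : ACTInstance → ACTInstance,
      RAM.PolyTimeComputable ACTInstance.encode ACTInstance.encode kernel ∧
      ∀ I : ACTInstance,
        (I.IsYes ↔ (kernel I).IsYes) ∧
        (kernel I).n ≤ 12 * I.k ∧
        (kernel I).k ≤ I.k := by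
  choose kernel hcomp hspec using RAM.Kernel.kernelize_spec (v := fun _ => 0)
  refine ⟨kernel, RAM.PolyTimeComputable.of_cmd (fun A => ?_) RAM.Kernel.kernelize hcomp, hspec⟩
  have h0 : RAM.arrayOf A.encode 0 = A.n := by simp [RAM.arrayOf, ACTInstance.encode]
  rw [h0]
  refine RAM.head_le_inputSize _ _ ?_
  simp only [List.length_cons, List.length_ofFn]
  nlinarith [Nat.le_mul_self A.n]
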